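/- Let $\mathcal G$ be a connected graph in the sense of Serre (vertices, oriented edges $e$ with source $s(e)$ and range $r(e)$, and a fixed-point free involution $e\mapsto\bar e$ with $s(\bar e)=r(e)$). A \emph{graph of C*-algebras with states} over $\mathcal G$ consists of unital C*-algebras $A_q$ ($q$ a vertex) and $B_e=B_{\bar e}$ ($e$ an edge), unital faithful $*$-homomorphisms $s_e:B_e\to A_{s(e)}$ (put $r_e=s_{\bar e}:B_e\to A_{r(e)}$), conditional expectations $E_e:A_{s(e)}\to s_e(B_e)$, and states $\varphi_q$ on $A_q$, $\varphi_e=\varphi_{\bar e}$ on $B_e$ with $\varphi_{s(e)}=\varphi_e\circ s_e^{-1}\circ E_e$. For vertices $q,p$ let $\mathcal H_{q,p}$ be the right Hilbert $A_p$-module obtained by separation and completion of the span of the elementary tensors $\hat a_0\otimes\cdots\otimes \hat a_{n-1}\otimes a_n$, where $(e_1,\dots,e_n)$ is a path from $q$ to $p$ ($n\ge 0$), $a_0\in A_q$, $a_i\in A_{r(e_i)}$, and $E_{e_{i+1}}(a_i)=0$ whenever $e_{i+1}=\bar e_i$. The inner product is: tensors over different paths are orthogonal, and for tensors $a,b$ over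 the same path, $\langle a,b\rangle=x_n$, where $x_0=a_0^*b_0$ and $x_k=a_k^*\,(r_{e_k}\circ s_{e_k}^{-1}\circ E_{e_k})(x_{k-1})\,b_k$. The algebra $A_q$ acts on $\mathcal H_{q,p}$ by left multiplication of the first letter and $A_p$ on the right by right multiplication of the last letter. For an edge $e$ let $u^p_e:\mathcal H_{r(e),p}\to\mathcal H_{s(e),p}$ be the unitary that maps $\hat a_0\otimes\xi$ to $\hat 1\otimes\hat a_0\otimes\xi$ (adding the edge $e$), except that, if the path of the tensor starts with $\bar e$, only $a_0-E_{\bar e}(a_0)$ is treated so, and the part $E_{\bar e}(a_0)\otimes\xi$ is sent to $(r_{\bar e}\circ s_{\bar e}^{-1}\circ E_{\bar e})(a_0)\,\xi$; one has $(u_e^p)^*=u_{\bar e}^p$. For a path $w=(e_1,\dots,e_n)$ put $u^p_w=u^p_{e_1}\cdots u^p_{e_n}$. The reduced fundamental C*-algebra $P_p(p_0)\subset\mathcal L_{A_p}(\mathcal H_{p_0,p})$ rooted in $p_0$ with base $p$ is the C*-algebra generated by the operators $(u^p_z)^*a\,u^p_w$, for $q$ a vertex, $z,w$ paths from $q$ to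 $p_0$ and $a\in A_q$; put $P(p_0)=P_{p_0}(p_0)$. A \emph{reduced operator} of $P_p(p_0)$ is an operator $a_0u^p_{e_1}a_1\cdots u^p_{e_n}a_n$ with $(e_1,\dots,e_n)$ a closed path at $p_0$, $n\ge 0$, $a_0\in A_{p_0}$, $a_i\in A_{r(e_i)}$, and $E_{e_{i+1}}(a_i)=0$ whenever $1\le i<n$ and $e_{i+1}=\bar e_i$ (for $n=0$ it is an element of $A_{p_0}$). Let $(H_{p_0,\varphi_p},\pi_{p_0,\varphi_p},\eta_{p_0,\varphi_p})$ be the GNS construction of $(\mathcal H_{p_0,p},\varphi_p)$: $H_{p_0,\varphi_p}$ is the separation and completion of $\mathcal H_{p_0,p}$ for the scalar product $\varphi_p(\langle x,y\rangle)$, $\pi_{p_0,\varphi_p}$ is the induced representation of $P_p(p_0)$, and $\eta_{p_0,\varphi_p}:\mathcal H_{p_0,p}\to H_{p_0,\varphi_p}$ is the canonical map. For any two vertices $p_0,p$: (1) For every vertex $r$ there is a unique state $\varphi$ on $P_r(p_0)$, the \emph{fundamental state}, that restricts to $\varphi_{p_0}$ on $A_{p_0}$ (that is, $\varphi(a)=\varphi_{p_0}(a)$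 for the operator of left multiplication by $a$) and vanishes on the reduced operators with $n\ge1$. For every path $g$ from $p_0$ to $r$ without backtracking (for instance the geodesic of a maximal subtree), the vector $\xi=\eta_{p_0,\varphi_r}(u^r_g(1_{A_r}))$ is cyclic for $\pi_{p_0,\varphi_r}(P_r(p_0))$ and $\langle\xi,\pi_{p_0,\varphi_r}(x)\xi\rangle=\varphi(x)$ for all $x\in P_r(p_0)$; so $(H_{p_0,\varphi_r},\pi_{p_0,\varphi_r},\xi)$ is the GNS construction of $\varphi$. (2) There is a unitary $V:H_{p_0,\varphi_p}\to H_{p_0,\varphi_{p_0}}$ such that, for every reduced operator, $$V\,\pi_{p_0,\varphi_p}(a_0u^p_{e_1}\cdots u^p_{e_n}a_n)\,V^*=\pi_{p_0,\varphi_{p_0}}(a_0u^{p_0}_{e_1}\cdots u^{p_0}_{e_n}a_n).$$ (3) If moreover the states $\varphi_{p_0}$ and $\varphi_p$ are faithful, there exists a unique $*$-isomorphism from $P(p_0)$ to $P_p(p_0)$ that maps $a_0u^{p_0}_{e_1}\cdots u^{p_0}_{e_n}a_n$ to $a_0u^{p}_{e_1}\cdots u^{p}_{e_n}a_n$ for every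 reduced operator. -/

import Mathlib

open scoped ComplexOrder MulOpposite InnerProductSpace
open MulOpposite UniformSpace

set_option linter.unusedSectionVars false
set_option linter.checkUnivs false

/-- The data of a semi-inner-product right module over a C⋆-algebra `A`: a complex vector space `X`
with a right action of `A` and a positive `A`-valued sesquilinear form, linear in the second
variable. (As in Mathlib's `CStarModule`, the module laws of the right action are not listed; they
hold automatically as soon as the form is definite.) -/
structure PreHilbertModuleCore (A X : Type*) [CStarAlgebra A] [PartialOrder A]
    [AddCommGroup X] [Module ℂ X] [SMul Aᵐᵒᵖ X] where
  inner : X → X → A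
  inner_add_right : ∀ x y z, inner x (y + z) = inner x y + inner x z
  inner_smul_right : ∀ (c : ℂ) x y, inner x (c • y) = c • inner x y
  inner_op_smul_right : ∀ (a : A) x y, inner x (op a • y) = inner x y * a
  star_inner : ∀ x y, star (inner x y) = inner y x
  inner_self_nonneg : ∀ x, 0 ≤ inner x x

/-- A right pre-Hilbert `A`-module `X`, with (semi)norm `‖x‖ = ‖⟪x, x⟫‖ ^ (1/2)`. A right Hilbert
`A`-module is a complete normed space with this structure. -/
class PreHilbertModule (A : outParam Type*) (X : Type*) [CStarAlgebra A] [PartialOrder A]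
    [SeminormedAddCommGroup X] [NormedSpace ℂ X] [SMul Aᵐᵒᵖ X] extends Inner A X where
  inner_add_right : ∀ x y z : X, inner x (y + z) = inner x y + inner x z
  inner_smul_right : ∀ (c : ℂ) (x y : X), inner x (c • y) = c • inner x y
  inner_op_smul_right : ∀ (a : A) (x y : X), inner x (op a • y) = inner x y * a
  star_inner : ∀ x y : X, star (inner x y) = inner y x
  inner_self_nonneg : ∀ x : X, 0 ≤ inner x x
  norm_sq_eq : ∀ x : X, ‖x‖ ^ 2 = ‖inner x x‖

namespace PreHilbertModuleCore

variable {A X : Type*} [CStarAlgebra A] [PartialOrder A] [StarOrderedRing A]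
  [AddCommGroup X] [Module ℂ X] [SMul Aᵐᵒᵖ X] (c : PreHilbertModuleCore A X)

lemma inner_add_left (x y z : X) : c.inner (x + y) z = c.inner x z + c.inner y z := by
  rw [← c.star_inner, c.inner_add_right, star_add, c.star_inner, c.star_inner]

lemma inner_smul_left (k : ℂ) (x y : X) : c.inner (k • x) y = star k • c.inner x y := by
  rw [← c.star_inner, c.inner_smul_right, star_smul, c.star_inner]

lemma inner_op_smul_left (a : A) (x y : X) : c.inner (op a • x) y = star a * c.inner x y := by
  rw [← c.star_inner, c.inner_op_smul_right, star_mul, c.star_inner]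

lemma norm_inner_sq_le (x y : X) : ‖c.inner x y‖ ^ 2 ≤ ‖c.inner x x‖ * ‖c.inner y y‖ := by
  have key : ∀ N : ℝ, ‖c.inner x x‖ < N → ‖c.inner x y‖ ^ 2 ≤ N * ‖c.inner y y‖ := by
    intro N hN
    have hN0 : 0 < N := (norm_nonneg _).trans_lt hN
    set a := c.inner x y with ha
    have h0 := c.inner_self_nonneg (op a • x + (-(N : ℂ)) • y)
    have h1 : c.inner (op a • x + (-(N : ℂ)) • y) (op a • x + (-(N : ℂ)) • y)
        = star a * c.inner x x * a - (2 * N) • (star a * a) + (N * N) • c.inner y y := by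
      have hyx : c.inner y x = star a := by rw [ha, c.star_inner]
      have hs : star (-(N : ℂ)) = -(N : ℂ) := by simp
      simp only [c.inner_add_right, c.inner_add_left, c.inner_smul_right, c.inner_smul_left,
        c.inner_op_smul_right, c.inner_op_smul_left, hyx, ← ha, hs]
      simp only [← Complex.coe_smul, ← mul_assoc, Complex.ofReal_mul, Complex.ofReal_ofNat]
      module
    have h2 : star a * c.inner x x * a ≤ N • (star a * a) := by
      refine (CStarAlgebra.star_left_conjugate_le_norm_smul
        (hb := (c.star_inner x x : IsSelfAdjoint _))).trans ?_
      exact smul_le_smul_of_nonneg_right hN.le (star_mul_self_nonneg a)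
    rw [h1] at h0
    have h3 : star a * a ≤ N • c.inner y y := by
      have : 0 ≤ N • (N • c.inner y y - star a * a) := by
        refine h0.trans ?_
        have : (N * N) • c.inner y y = N • (N • c.inner y y) := by rw [smul_smul]
        rw [this, two_mul, add_smul, smul_sub]
        have h4 := sub_nonneg.2 h2
        rw [← sub_nonneg]
        convert h4 using 1
        abel
      have h5 := smul_nonneg (inv_nonneg.2 hN0.le) this
      rw [smul_smul, inv_mul_cancel₀ hN0.ne', one_smul] at h5
      exact sub_nonneg.1 h5
    have h6 := CStarAlgebra.norm_le_norm_of_nonneg_of_le (star_mul_self_nonneg a) h3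
    rw [CStarRing.norm_star_mul_self, norm_smul, Real.norm_of_nonneg hN0.le] at h6
    rw [sq]; exact h6
  refine le_of_forall_pos_le_add fun ε hε => ?_
  have hy : 0 < ‖c.inner y y‖ + 1 := by positivity
  have h := key (‖c.inner x x‖ + ε / (‖c.inner y y‖ + 1)) (by linarith [div_pos hε hy])
  refine h.trans ?_
  rw [add_mul]
  have : ε / (‖c.inner y y‖ + 1) * ‖c.inner y y‖ ≤ ε := by
    rw [div_mul_eq_mul_div, div_le_iff₀ hy]
    nlinarith [norm_nonneg (c.inner y y)]
  linarith

lemma norm_inner_le (x y : X) :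
    ‖c.inner x y‖ ≤ √‖c.inner x x‖ * √‖c.inner y y‖ := by
  rw [← Real.sqrt_mul (norm_nonneg _)]
  exact Real.le_sqrt_of_sq_le (c.norm_inner_sq_le x y)

/-- The seminorm `x ↦ ‖⟪x, x⟫‖ ^ (1/2)`. -/
noncomputable def seminorm : Seminorm ℂ X :=
  Seminorm.of (fun x => √‖c.inner x x‖)
    (by
      intro x y
      refine Real.sqrt_le_iff.2 ⟨by positivity, ?_⟩
      rw [c.inner_add_left, c.inner_add_right, c.inner_add_right]
      refine (norm_add_le _ _).trans ((add_le_add (norm_add_le _ _) (norm_add_le _ _)).trans ?_)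
      have h1 := c.norm_inner_le x y
      have h2 := c.norm_inner_le y x
      have h3 := Real.mul_self_sqrt (norm_nonneg (c.inner x x))
      have h4 := Real.mul_self_sqrt (norm_nonneg (c.inner y y))
      nlinarith)
    (by
      intro k x
      rw [c.inner_smul_left, c.inner_smul_right, norm_smul, norm_smul, norm_star, ← mul_assoc,
        Real.sqrt_mul (by positivity), Real.sqrt_mul_self (norm_nonneg _)])

/-- The seminormed group structure given by `‖x‖ = ‖⟪x, x⟫‖ ^ (1/2)`. -/
@[reducible] noncomputable def toSeminormedAddCommGroup : SeminormedAddCommGroup X :=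
  (c.seminorm.toAddGroupSeminorm).toSeminormedAddCommGroup

/-- The seminormed space structure given by `‖x‖ = ‖⟪x, x⟫‖ ^ (1/2)`. -/
@[reducible] noncomputable def toNormedSpace :
    letI := c.toSeminormedAddCommGroup
    NormedSpace ℂ X :=
  letI := c.toSeminormedAddCommGroup
  { norm_smul_le := fun k x => (map_smul_eq_mul c.seminorm k x).le }

/-- The pre-Hilbert module attached to a core. -/
@[reducible] noncomputable def toPreHilbertModule :
    letI := c.toSeminormedAddCommGroup
    letI := c.toNormedSpace
    PreHilbertModule A X :=
  letI := c.toSeminormedAddCommGroup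
  letI := c.toNormedSpace
  { inner := c.inner
    inner_add_right := c.inner_add_right
    inner_smul_right := c.inner_smul_right
    inner_op_smul_right := c.inner_op_smul_right
    star_inner := c.star_inner
    inner_self_nonneg := c.inner_self_nonneg
    norm_sq_eq := fun x => Real.sq_sqrt (norm_nonneg (c.inner x x)) }

end PreHilbertModuleCore

namespace PreHilbertModule

section Semi

variable {A X Y : Type*} [CStarAlgebra A] [PartialOrder A] [StarOrderedRing A]
  [SeminormedAddCommGroup X] [NormedSpace ℂ X] [SMul Aᵐᵒᵖ X] [PreHilbertModule A X]

lemma inner_add_left (x y z : X) : inner A (x + y) z = inner A x z + inner A y z := by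
  rw [← star_inner, inner_add_right, star_add, star_inner, star_inner]

lemma inner_smul_left (k : ℂ) (x y : X) : inner A (k • x) y = star k • inner A x y := by
  rw [← star_inner, inner_smul_right, star_smul, star_inner]

lemma norm_inner_le (x y : X) : ‖inner A x y‖ ≤ ‖x‖ * ‖y‖ := by
  have h := PreHilbertModuleCore.norm_inner_le (A := A) (X := X)
    ⟨inner A, inner_add_right, inner_smul_right, inner_op_smul_right, star_inner,
      inner_self_nonneg⟩ x y
  simpa only [← norm_sq_eq, Real.sqrt_sq (norm_nonneg _)] using h

lemma norm_le_of_inner_le {x : X} {r : ℝ} (hr : 0 ≤ r) (h : ‖inner A x x‖ ≤ r ^ 2) : ‖x‖ ≤ r := by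
  rw [← norm_sq_eq] at h
  exact (pow_le_pow_iff_left₀ (norm_nonneg _) hr two_ne_zero).1 h

/-- The inner product as a sesquilinear map. -/
def innerₛₗ : X →ₗ⋆[ℂ] X →ₗ[ℂ] A where
  toFun x := { toFun := inner A x, map_add' := inner_add_right x,
               map_smul' := fun k y => inner_smul_right k x y }
  map_add' x y := by ext z; exact inner_add_left x y z
  map_smul' k x := by ext z; exact inner_smul_left k x z

/-- The inner product as a bounded sesquilinear map. -/
noncomputable def innerSL : X →L⋆[ℂ] X →L[ℂ] A :=
  LinearMap.mkContinuous₂ innerₛₗ 1 fun x y => by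
    rw [one_mul]; exact norm_inner_le x y

lemma innerSL_apply (x y : X) : innerSL (A := A) x y = inner A x y := rfl

lemma inner_sub_right (x y z : X) : inner A x (y - z) = inner A x y - inner A x z :=
  map_sub (innerSL x) y z

lemma inner_sub_left (x y z : X) : inner A (x - y) z = inner A x z - inner A y z := by
  rw [← star_inner, inner_sub_right, star_sub, star_inner, star_inner]

@[simp] lemma inner_zero_right (x : X) : inner A x 0 = 0 := map_zero (innerSL x)

@[simp] lemma inner_zero_left (x : X) : inner A 0 x = 0 := by
  rw [← star_inner, inner_zero_right, star_zero]

lemma continuous_inner : Continuous fun p : X × X => inner A p.1 p.2 := by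
  simp only [← innerSL_apply]
  fun_prop

lemma inner_op_smul_left (a : A) (x y : X) : inner A (op a • x) y = star a * inner A x y := by
  rw [← star_inner, inner_op_smul_right, star_mul, star_inner]

lemma lipschitz_op_smul (a : A) : LipschitzWith ‖a‖₊ fun x : X => op a • x := by
  refine LipschitzWith.of_dist_le_mul fun x y => ?_
  rw [dist_eq_norm, dist_eq_norm]
  refine norm_le_of_inner_le (A := A) (by positivity) ?_
  have : inner A (op a • x - op a • y) (op a • x - op a • y)
      = star a * inner A (x - y) (x - y) * a := by
    simp only [inner_sub_left, inner_sub_right, inner_op_smul_left, inner_op_smul_right]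
    noncomm_ring
  rw [this, mul_pow, norm_sq_eq (A := A) (x - y)]
  refine (norm_mul_le _ _).trans ?_
  refine (mul_le_mul_of_nonneg_right (norm_mul_le _ _) (norm_nonneg _)).trans ?_
  rw [norm_star, coe_nnnorm]
  apply le_of_eq; ring

instance : UniformContinuousConstSMul Aᵐᵒᵖ X :=
  ⟨fun a => (lipschitz_op_smul (A := A) (unop a)).uniformContinuous⟩

end Semi

section Completion

variable {A X Y : Type*} [CStarAlgebra A] [PartialOrder A] [StarOrderedRing A]
  [SeminormedAddCommGroup X] [NormedSpace ℂ X] [SMul Aᵐᵒᵖ X] [PreHilbertModule A X]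
  [SeminormedAddCommGroup Y] [NormedSpace ℂ Y] [SMul Aᵐᵒᵖ Y] [PreHilbertModule A Y]

lemma completion_inner_coe (x y : X) :
    inner A (x : Completion X) (y : Completion X) = inner A x y :=
  (Completion.isDenseInducing_coe.prodMap Completion.isDenseInducing_coe).extend_eq
    (f := Function.uncurry (inner A)) (continuous_inner (X := X)) (x, y)

lemma completion_continuous_inner :
    Continuous (Function.uncurry (inner A (E := Completion X))) := by
  let inner' : X →+ X →+ A :=
    { toFun := fun x => (innerₛₗ (A := A) x).toAddMonoidHom
      map_zero' := by ext x; exact inner_zero_left _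
      map_add' := fun x y => by ext z; exact inner_add_left _ _ _ }
  have : Continuous fun p : X × X => inner' p.1 p.2 := continuous_inner
  rw [Completion.toInner, inner, Function.uncurry_curry _]
  change Continuous (((Completion.isDenseInducing_toCompl X).prodMap
    (Completion.isDenseInducing_toCompl X)).extend fun p : X × X => inner' p.1 p.2)
  exact (Completion.isDenseInducing_toCompl X).extend_Z_bilin
    (Completion.isDenseInducing_toCompl X) this

@[fun_prop]
lemma _root_.Continuous.completion_inner {α : Type*} [TopologicalSpace α] {f g : α → Completion X}
    (hf : Continuous f) (hg : Continuous g) : Continuous fun t => inner A (f t) (g t) :=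
  completion_continuous_inner.comp (hf.prodMk hg)

/-- The separation-completion of a pre-Hilbert module is a Hilbert module. -/
noncomputable instance : PreHilbertModule A (Completion X) where
  inner_add_right x y z := by
    refine Completion.induction_on₃ x y z (isClosed_eq ?_ ?_) fun a b c => ?_
    · exact completion_continuous_inner.comp
        (continuous_fst.prodMk (continuous_snd.fst.add continuous_snd.snd))
    · exact (completion_continuous_inner.comp (continuous_fst.prodMk continuous_snd.fst)).add
        (completion_continuous_inner.comp (continuous_fst.prodMk continuous_snd.snd))
    · simp only [← Completion.coe_add, completion_inner_coe, inner_add_right]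
  inner_smul_right k x y := by
    refine Completion.induction_on₂ x y (isClosed_eq ?_ ?_) fun a b => ?_
    · exact completion_continuous_inner.comp (continuous_fst.prodMk (continuous_snd.const_smul k))
    · exact (completion_continuous_inner.comp (continuous_fst.prodMk continuous_snd)).const_smul k
    · simp only [← Completion.coe_smul, completion_inner_coe, inner_smul_right]
  inner_op_smul_right a x y := by
    refine Completion.induction_on₂ x y (isClosed_eq ?_ ?_) fun a b => ?_
    · exact completion_continuous_inner.comp
        (continuous_fst.prodMk (Completion.continuous_map.comp continuous_snd))
    · exact (completion_continuous_inner.comp (continuous_fst.prodMk continuous_snd)).mul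
        continuous_const
    · simp only [← Completion.coe_smul, completion_inner_coe, inner_op_smul_right]
  star_inner x y := by
    refine Completion.induction_on₂ x y (isClosed_eq ?_ ?_) fun a b => ?_
    · exact (completion_continuous_inner.comp (continuous_fst.prodMk continuous_snd)).star
    · exact completion_continuous_inner.comp (continuous_snd.prodMk continuous_fst)
    · simp only [completion_inner_coe, star_inner]
  inner_self_nonneg x := by
    refine Completion.induction_on x (CStarAlgebra.isClosed_nonneg.preimage ?_) fun a => ?_
    · exact completion_continuous_inner.comp (continuous_id.prodMk continuous_id)
    · simp only [completion_inner_coe, inner_self_nonneg]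
  norm_sq_eq x := by
    refine Completion.induction_on x (isClosed_eq ?_ ?_) fun a => ?_
    · exact continuous_norm.pow 2
    · exact (completion_continuous_inner.comp (continuous_id.prodMk continuous_id)).norm
    · simp only [completion_inner_coe, Completion.norm_coe, norm_sq_eq (A := A)]

end Completion

end PreHilbertModule

/-! ### Adjointable operators -/

section Adjointable

variable (A : Type*) {E F K : Type*} [CStarAlgebra A] [PartialOrder A] [StarOrderedRing A]
  [NormedAddCommGroup E] [NormedSpace ℂ E] [SMul Aᵐᵒᵖ E] [PreHilbertModule A E]
  [NormedAddCommGroup F] [NormedSpace ℂ F] [SMul Aᵐᵒᵖ F] [PreHilbertModule A F]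
  [NormedAddCommGroup K] [NormedSpace ℂ K] [SMul Aᵐᵒᵖ K] [PreHilbertModule A K]

/-- `S` is the adjoint of `T`: `⟪T x, y⟫ = ⟪x, S y⟫` for all `x`, `y`. (Operators with an adjoint
are automatically `A`-linear.) -/
def IsAdjointOp (T : E →L[ℂ] F) (S : F →L[ℂ] E) : Prop :=
  ∀ x y, inner A (T x) y = inner A x (S y)

variable {A}

lemma IsAdjointOp.symm {T : E →L[ℂ] F} {S : F →L[ℂ] E} (h : IsAdjointOp A T S) :
    IsAdjointOp A S T := fun x y => by
  rw [← PreHilbertModule.star_inner, ← h, PreHilbertModule.star_inner]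

lemma IsAdjointOp.comp {T : E →L[ℂ] F} {S : F →L[ℂ] E} {T' : F →L[ℂ] K} {S' : K →L[ℂ] F}
    (h : IsAdjointOp A T S) (h' : IsAdjointOp A T' S') :
    IsAdjointOp A (T' ∘L T) (S ∘L S') := fun x y => by
  simp only [ContinuousLinearMap.comp_apply]; rw [h', h]

lemma PreHilbertModule.eq_zero_of_inner_self {x : E} (h : inner A x x = 0) : x = 0 := by
  have := PreHilbertModule.norm_sq_eq (A := A) x
  rw [h, norm_zero] at this
  exact norm_eq_zero.1 (pow_eq_zero_iff two_ne_zero |>.1 this)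

lemma PreHilbertModule.ext_inner {x y : E} (h : ∀ z : E, inner A z x = inner A z y) : x = y := by
  rw [← sub_eq_zero]
  apply PreHilbertModule.eq_zero_of_inner_self (A := A)
  rw [PreHilbertModule.inner_sub_right, h, sub_self]

lemma IsAdjointOp.unique {T : E →L[ℂ] F} {S S' : F →L[ℂ] E} (h : IsAdjointOp A T S)
    (h' : IsAdjointOp A T S') : S = S' := by
  ext y
  exact PreHilbertModule.ext_inner (A := A) fun z => by rw [← h, ← h']

lemma IsAdjointOp.norm_sq_le {T : E →L[ℂ] F} {S : F →L[ℂ] E} (h : IsAdjointOp A T S) :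
    ‖T‖ ^ 2 ≤ ‖S ∘L T‖ := by
  rw [← Real.le_sqrt (norm_nonneg _) (norm_nonneg _)]
  refine T.opNorm_le_bound (Real.sqrt_nonneg _) fun x => ?_
  rw [← pow_le_pow_iff_left₀ (norm_nonneg _) (by positivity) two_ne_zero, mul_pow,
    Real.sq_sqrt (norm_nonneg _), PreHilbertModule.norm_sq_eq (A := A), h]
  calc _ ≤ ‖x‖ * ‖(S ∘L T) x‖ := PreHilbertModule.norm_inner_le x _
    _ ≤ ‖x‖ * (‖S ∘L T‖ * ‖x‖) := by gcongr; exact (S ∘L T).le_opNorm x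
    _ = ‖S ∘L T‖ * ‖x‖ ^ 2 := by ring

lemma IsAdjointOp.norm_le {T : E →L[ℂ] F} {S : F →L[ℂ] E} (h : IsAdjointOp A T S) :
    ‖T‖ ≤ ‖S‖ := by
  have h1 := h.norm_sq_le.trans (ContinuousLinearMap.opNorm_comp_le S T)
  rcases (norm_nonneg T).eq_or_lt with h0 | h0
  · rw [← h0]; positivity
  · exact le_of_mul_le_mul_right (by rwa [sq] at h1) h0

lemma IsAdjointOp.norm_eq {T : E →L[ℂ] F} {S : F →L[ℂ] E} (h : IsAdjointOp A T S) :
    ‖T‖ = ‖S‖ := le_antisymm h.norm_le h.symm.norm_le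

variable (A E)

/-- The algebra `𝓛_A(E)` of adjointable operators on a Hilbert `A`-module. -/
def adjointable : Subalgebra ℂ (E →L[ℂ] E) where
  carrier := {T | ∃ S, IsAdjointOp A T S}
  mul_mem' := by
    rintro T T' ⟨S, h⟩ ⟨S', h'⟩
    exact ⟨S' ∘L S, h'.comp h⟩
  add_mem' := by
    rintro T T' ⟨S, h⟩ ⟨S', h'⟩
    refine ⟨S + S', fun x y => ?_⟩
    simp only [add_apply, PreHilbertModule.inner_add_left,
      PreHilbertModule.inner_add_right]
    rw [h, h']
  algebraMap_mem' r := by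
    refine ⟨algebraMap ℂ _ (star r), fun x y => ?_⟩
    simp only [Algebra.algebraMap_eq_smul_one, smul_apply,
      one_apply_eq_self, PreHilbertModule.inner_smul_left,
      PreHilbertModule.inner_smul_right]

variable {A E}

namespace adjointable

/-- The involution of `𝓛_A(E)` is the adjoint. -/
noncomputable instance : Star (adjointable A E) :=
  ⟨fun T => ⟨T.2.choose, T.1, T.2.choose_spec.symm⟩⟩

lemma isAdjointOp_star (T : adjointable A E) : IsAdjointOp A T.1 (star T).1 := T.2.choose_spec

lemma star_eq {T : adjointable A E} {S : E →L[ℂ] E} (h : IsAdjointOp A T.1 S) :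
    (star T).1 = S := (isAdjointOp_star T).unique h

noncomputable instance : StarRing (adjointable A E) where
  star_involutive T := Subtype.ext (star_eq (isAdjointOp_star T).symm)
  star_mul T T' := Subtype.ext (star_eq ((isAdjointOp_star T').comp (isAdjointOp_star T)))
  star_add T T' := Subtype.ext (star_eq fun x y => by
    have h := isAdjointOp_star T x y
    have h' := isAdjointOp_star T' x y
    simp only [Subalgebra.coe_add, add_apply, PreHilbertModule.inner_add_left,
      PreHilbertModule.inner_add_right, h, h'])

instance : StarModule ℂ (adjointable A E) where
  star_smul c T := Subtype.ext (star_eq fun x y => by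
    have h := isAdjointOp_star T x y
    simp only [Subalgebra.coe_smul, smul_apply,
      PreHilbertModule.inner_smul_left, PreHilbertModule.inner_smul_right, h])

instance : CStarRing (adjointable A E) where
  norm_mul_self_le T := by
    have h := (isAdjointOp_star T).norm_sq_le
    rw [sq] at h
    exact h

lemma isClosed [CompleteSpace E] : IsClosed (adjointable A E : Set (E →L[ℂ] E)) := by
  rw [← isSeqClosed_iff_isClosed]
  intro T T₀ hT hlim
  choose S hS using hT
  have hcau : CauchySeq S := by
    have := hlim.cauchySeq
    rw [Metric.cauchySeq_iff] at this ⊢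
    intro ε hε
    obtain ⟨N, hN⟩ := this ε hε
    refine ⟨N, fun m hm n hn => ?_⟩
    have hd : IsAdjointOp A (T m - T n) (S m - S n) := fun x y => by
      simp only [sub_apply, PreHilbertModule.inner_sub_left,
        PreHilbertModule.inner_sub_right]
      rw [hS, hS]
    have := hN m hm n hn
    rwa [dist_eq_norm, hd.norm_eq, ← dist_eq_norm] at this
  obtain ⟨S₀, hS₀⟩ := cauchySeq_tendsto_of_complete hcau
  refine ⟨S₀, fun x y => ?_⟩
  have c := PreHilbertModule.continuous_inner (A := A) (X := E)
  have h1 : Filter.Tendsto (fun n => inner A (T n x) y) Filter.atTop (nhds (inner A (T₀ x) y)) :=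
    (c.tendsto (T₀ x, y)).comp
      ((((ContinuousLinearMap.apply ℂ E x).continuous.tendsto _).comp hlim).prodMk_nhds
        tendsto_const_nhds)
  have h2 : Filter.Tendsto (fun n => inner A x (S n y)) Filter.atTop (nhds (inner A x (S₀ y))) :=
    (c.tendsto (x, S₀ y)).comp
      (tendsto_const_nhds.prodMk_nhds
        (((ContinuousLinearMap.apply ℂ E y).continuous.tendsto _).comp hS₀))
  refine tendsto_nhds_unique h1 (h2.congr fun n => (hS n x y).symm)

/-- The adjointable operators on a Hilbert module form a C⋆-algebra. -/
noncomputable instance [CompleteSpace E] : CStarAlgebra (adjointable A E) where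
  complete := (isClosed (A := A) (E := E)).completeSpace_coe.complete

lemma inner_apply_self_le [CompleteSpace E] (T : adjointable A E) (x : E) :
    inner A (T.1 x) (T.1 x) ≤ (‖T‖ ^ 2) • inner A x x := by
  let _ : PartialOrder (adjointable A E) := CStarAlgebra.spectralOrder _
  have _ : StarOrderedRing (adjointable A E) := CStarAlgebra.spectralOrderedRing _
  have h1 := CStarAlgebra.star_mul_le_algebraMap_norm_sq (a := T)
  rw [← sub_nonneg, CStarAlgebra.nonneg_iff_eq_star_mul_self] at h1
  obtain ⟨S, hS⟩ := h1
  have h2 : inner A x ((star S * S).1 x) = inner A (S.1 x) (S.1 x) :=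
    (isAdjointOp_star S x _).symm
  rw [← hS] at h2
  have h3 : (algebraMap ℝ (adjointable A E) (‖T‖ ^ 2) - star T * T).1 x
      = ((‖T‖ ^ 2 : ℝ) : ℂ) • x - (star T).1 (T.1 x) := by
    rw [Algebra.algebraMap_eq_smul_one, ← Complex.coe_smul]
    rfl
  rw [h3, PreHilbertModule.inner_sub_right, PreHilbertModule.inner_smul_right,
    ← isAdjointOp_star T x] at h2
  rw [← sub_nonneg, ← Complex.coe_smul, h2]
  exact PreHilbertModule.inner_self_nonneg _

end adjointable

end Adjointable

/-! ### States and GNS constructions -/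

/-- A state on a unital complex ⋆-algebra. -/
def IsState {A : Type*} [Ring A] [StarRing A] [Algebra ℂ A] (φ : A →ₗ[ℂ] ℂ) : Prop :=
  φ 1 = 1 ∧ ∀ a, 0 ≤ φ (star a * a)

/-- A faithful functional. -/
def IsFaithful {A : Type*} [Ring A] [StarRing A] [Algebra ℂ A] (φ : A →ₗ[ℂ] ℂ) : Prop :=
  ∀ a, φ (star a * a) = 0 → a = 0

section GNS

variable {A : Type*} [CStarAlgebra A] [PartialOrder A] [StarOrderedRing A]

lemma IsState.nonneg {φ : A →ₗ[ℂ] ℂ} (hφ : IsState φ) {a : A} (ha : 0 ≤ a) : 0 ≤ φ a := by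
  obtain ⟨b, rfl⟩ := CStarAlgebra.nonneg_iff_eq_star_mul_self.1 ha
  exact hφ.2 b

lemma IsState.map_star {φ : A →ₗ[ℂ] ℂ} (hφ : IsState φ) (a : A) : φ (star a) = star (φ a) :=
  StarHomClass.map_star (PositiveLinearMap.mk₀ φ fun _ h => hφ.nonneg h) a

variable (E : Type*) [NormedAddCommGroup E] [NormedSpace ℂ E] [SMul Aᵐᵒᵖ E] [PreHilbertModule A E]

/-- A copy of the Hilbert `A`-module `E`, carrying the scalar semi-inner product
`φ ⟪x, y⟫` attached to a state `φ` of `A`. -/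
@[nolint unusedArguments]
def PreGNSSpace {φ : A →ₗ[ℂ] ℂ} (_ : IsState φ) : Type _ := E

namespace PreGNSSpace

variable {φ : A →ₗ[ℂ] ℂ} (hφ : IsState φ)

instance : AddCommGroup (PreGNSSpace E hφ) := inferInstanceAs (AddCommGroup E)
instance : Module ℂ (PreGNSSpace E hφ) := inferInstanceAs (Module ℂ E)

/-- The identity map from `E` to its copy. -/
def equiv : E ≃ₗ[ℂ] PreGNSSpace E hφ := LinearEquiv.refl ℂ E

/-- The semi-inner product `φ ⟪x, y⟫`. -/
@[reducible] noncomputable def core : PreInnerProductSpace.Core ℂ (PreGNSSpace E hφ) where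
  inner x y := φ (inner A ((equiv E hφ).symm x) ((equiv E hφ).symm y))
  conj_inner_symm x y := by
    rw [starRingEnd_apply, ← hφ.map_star, PreHilbertModule.star_inner]
  re_inner_nonneg x :=
    (RCLike.nonneg_iff.1 (hφ.nonneg (PreHilbertModule.inner_self_nonneg _))).1
  add_left x y z := by rw [map_add, PreHilbertModule.inner_add_left, map_add]
  smul_left x y r := by
    rw [map_smul, PreHilbertModule.inner_smul_left, map_smul]; rfl

noncomputable instance : SeminormedAddCommGroup (PreGNSSpace E hφ) :=
  InnerProductSpace.Core.toSeminormedAddCommGroup (c := core E hφ)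
noncomputable instance : InnerProductSpace ℂ (PreGNSSpace E hφ) :=
  InnerProductSpace.ofCore (core E hφ)

variable {E hφ}

lemma inner_def (x y : PreGNSSpace E hφ) :
    inner ℂ x y = φ (inner A ((equiv E hφ).symm x) ((equiv E hφ).symm y)) := rfl

end PreGNSSpace

/-- The Hilbert space of the GNS construction of `(E, φ)`: the separation and completion of the
Hilbert `A`-module `E` with respect to the scalar product `φ ⟪x, y⟫`. -/
abbrev GNSSpace {φ : A →ₗ[ℂ] ℂ} (hφ : IsState φ) : Type _ := Completion (PreGNSSpace E hφ)

variable {φ : A →ₗ[ℂ] ℂ} (hφ : IsState φ)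

/-- The canonical linear map `η` with dense range from `E` to its GNS space. -/
noncomputable def gnsVector : E →ₗ[ℂ] GNSSpace E hφ :=
  (Completion.toComplₗᵢ (𝕜 := ℂ) (E := PreGNSSpace E hφ)).toLinearMap ∘ₗ
    (PreGNSSpace.equiv E hφ).toLinearMap

variable {E} [CompleteSpace E]

/-- An adjointable operator, on the pre-GNS space. -/
noncomputable def preGNSOp (T : adjointable A E) : PreGNSSpace E hφ →L[ℂ] PreGNSSpace E hφ :=
  ((PreGNSSpace.equiv E hφ).toLinearMap ∘ₗ T.1.toLinearMap ∘ₗ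
    (PreGNSSpace.equiv E hφ).symm.toLinearMap).mkContinuous ‖T‖ fun x => by
      set y := (PreGNSSpace.equiv E hφ).symm x with hy
      have hx : x = PreGNSSpace.equiv E hφ y := by simp [hy]
      rw [hx, ← pow_le_pow_iff_left₀ (norm_nonneg _) (by positivity) two_ne_zero, mul_pow,
        norm_sq_eq_re_inner (𝕜 := ℂ) (PreGNSSpace.equiv E hφ y),
        norm_sq_eq_re_inner (𝕜 := ℂ) (E := PreGNSSpace E hφ)]
      have h := hφ.nonneg (sub_nonneg.2 (adjointable.inner_apply_self_le T y))
      rw [map_sub, sub_nonneg, ← Complex.coe_smul, map_smul] at h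
      have := (RCLike.le_iff_re_im.1 h).1
      rw [smul_eq_mul, RCLike.re_eq_complex_re, Complex.re_ofReal_mul] at this
      exact this

/-- The representation `π : 𝓛_A(E) → B(H)` of the GNS construction of `(E, φ)`. -/
noncomputable def gnsRep : adjointable A E →⋆ₐ[ℂ] (GNSSpace E hφ →L[ℂ] GNSSpace E hφ) where
  toFun T := (preGNSOp hφ T).completion
  map_one' := by
    ext x
    induction x using Completion.induction_on with
    | hp => exact isClosed_eq (ContinuousLinearMap.continuous _) (ContinuousLinearMap.continuous _)
    | ih x => rw [ContinuousLinearMap.completion_apply_coe]; rfl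
  map_mul' T S := by
    ext x
    induction x using Completion.induction_on with
    | hp => exact isClosed_eq (ContinuousLinearMap.continuous _) (ContinuousLinearMap.continuous _)
    | ih x =>
      rw [mul_apply_eq_comp]
      simp only [ContinuousLinearMap.completion_apply_coe]; rfl
  map_zero' := by
    ext x
    induction x using Completion.induction_on with
    | hp => exact isClosed_eq (ContinuousLinearMap.continuous _) (ContinuousLinearMap.continuous _)
    | ih x => rw [ContinuousLinearMap.completion_apply_coe]; rfl
  map_add' T S := by
    ext x
    induction x using Completion.induction_on with
    | hp => exact isClosed_eq (ContinuousLinearMap.continuous _) (ContinuousLinearMap.continuous _)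
    | ih x =>
      rw [add_apply]
      simp only [ContinuousLinearMap.completion_apply_coe, ← Completion.coe_add]; rfl
  commutes' r := by
    ext x
    induction x using Completion.induction_on with
    | hp => exact isClosed_eq (ContinuousLinearMap.continuous _) (ContinuousLinearMap.continuous _)
    | ih x =>
      rw [ContinuousLinearMap.completion_apply_coe, Algebra.algebraMap_eq_smul_one,
        Algebra.algebraMap_eq_smul_one]
      exact Completion.coe_smul r x
  map_star' T := by
    rw [ContinuousLinearMap.star_eq_adjoint, ContinuousLinearMap.eq_adjoint_iff]
    intro x y
    induction x, y using Completion.induction_on₂ with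
    | hp =>
      exact isClosed_eq
        (Completion.continuous_inner.comp
          (((ContinuousLinearMap.continuous _).comp continuous_fst).prodMk continuous_snd))
        (Completion.continuous_inner.comp
          (continuous_fst.prodMk ((ContinuousLinearMap.continuous _).comp continuous_snd)))
    | ih x y =>
      rw [ContinuousLinearMap.completion_apply_coe, ContinuousLinearMap.completion_apply_coe,
        Completion.inner_coe, Completion.inner_coe, PreGNSSpace.inner_def, PreGNSSpace.inner_def]
      congr 1
      exact (adjointable.isAdjointOp_star T).symm _ _

lemma gnsRep_gnsVector (T : adjointable A E) (x : E) :
    gnsRep hφ T (gnsVector E hφ x) = gnsVector E hφ (T.1 x) :=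
  ContinuousLinearMap.completion_apply_coe _ _

end GNS

/-! ### Graphs of C⋆-algebras -/

universe u v w w'

open Quiver (reverse)

/-- A graph of C⋆-algebras over a connected graph in the sense of Serre: the graph is the quiver
`V`, whose (oriented) edges `e : p ⟶ q` come with an involutive, fixed point free reversal.
The equality of the C⋆-algebras `B_e` and `B_ē` is expressed by the coherent identification
`bar e`; the maps are `s_e : B_e → A_{s(e)}` and `r_e = s_ē : B_e = B_ē → A_{r(e)}`. -/
structure GraphOfCStarAlgebras (V : Type u) [Quiver.{v} V] [Quiver.HasInvolutiveReverse V] where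
  /-- every two vertices are joined by a path -/
  connected : ∀ p q : V, Nonempty (Quiver.Path p q)
  reverse_ne : ∀ (p : V) (e : p ⟶ p), reverse e ≠ e
  /-- the vertex algebras -/
  A : V → Type w
  /-- the edge algebras -/
  B : ∀ {p q : V}, (p ⟶ q) → Type w'
  [instA : ∀ q, CStarAlgebra (A q)]
  [instB : ∀ {p q : V} (e : p ⟶ q), CStarAlgebra (B e)]
  /-- the identification of `B_e` and `B_ē` -/
  bar : ∀ {p q : V} (e : p ⟶ q), B e ≃⋆ₐ[ℂ] B (reverse e)
  /-- the unital faithful ⋆-homomorphism `s_e` -/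
  s : ∀ {p q : V} (e : p ⟶ q), B e →⋆ₐ[ℂ] A p
  s_injective : ∀ {p q : V} (e : p ⟶ q), Function.Injective (s e)
  /-- identifying `B_e` with `B_ē` and then with the algebra of the reverse of `ē`, that is of `e`,
  gives the identity of `B_e` -/
  s_bar_bar : ∀ {p q : V} (e : p ⟶ q) (b : B e),
    s (reverse (reverse e)) (bar (reverse e) (bar e b)) = s e b

attribute [instance] GraphOfCStarAlgebras.instA GraphOfCStarAlgebras.instB

namespace GraphOfCStarAlgebras

variable {V : Type u} [Quiver.{v} V] [Quiver.HasInvolutiveReverse V]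

/-- The canonical order of the C⋆-algebra `A_q`. -/
noncomputable instance (G : GraphOfCStarAlgebras.{u, v, w, w'} V) (q : V) : PartialOrder (G.A q) :=
  CStarAlgebra.spectralOrder _

instance (G : GraphOfCStarAlgebras.{u, v, w, w'} V) (q : V) : StarOrderedRing (G.A q) :=
  CStarAlgebra.spectralOrderedRing _

/-- The ⋆-homomorphism `r_e = s_ē`. -/
def r (G : GraphOfCStarAlgebras.{u, v, w, w'} V) {p q : V} (e : p ⟶ q) : G.B e →⋆ₐ[ℂ] G.A q :=
  (G.s (reverse e)).comp (G.bar e : G.B e →⋆ₐ[ℂ] G.B (reverse e))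

end GraphOfCStarAlgebras

/-- A graph of C⋆-algebras with a conditional expectation `E_e` of `A_{s(e)}` onto the
C⋆-subalgebra `s_e(B_e)`, for every edge `e`: a positive, `s_e(B_e)`-bilinear projection. -/
structure GraphWithExpectations (V : Type u) [Quiver.{v} V] [Quiver.HasInvolutiveReverse V]
    extends GraphOfCStarAlgebras.{u, v, w, w'} V where
  E : ∀ {p q : V} (_ : p ⟶ q), A p →ₗ[ℂ] A p
  E_mem : ∀ {p q : V} (e : p ⟶ q) (a : A p), ∃ b, s e b = E e a
  E_apply_s : ∀ {p q : V} (e : p ⟶ q) (b : B e), E e (s e b) = s e b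
  E_left : ∀ {p q : V} (e : p ⟶ q) (b : B e) (a : A p), E e (s e b * a) = s e b * E e a
  E_right : ∀ {p q : V} (e : p ⟶ q) (b : B e) (a : A p), E e (a * s e b) = E e a * s e b
  /-- positivity -/
  E_pos : ∀ {p q : V} (e : p ⟶ q) (a : A p), ∃ c, E e (star a * a) = star c * c

namespace GraphWithExpectations

variable {V : Type u} [Quiver.{v} V] [Quiver.HasInvolutiveReverse V]
  (G : GraphWithExpectations.{u, v, w, w'} V)

/-- The map `s_e⁻¹ ∘ E_e : A_{s(e)} → B_e`. -/
noncomputable def sInvE {p q : V} (e : p ⟶ q) : G.A p →ₗ[ℂ] G.B e :=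
  (LinearEquiv.ofInjective (G.s e).toAlgHom.toLinearMap (G.s_injective e)).symm.toLinearMap ∘ₗ
    (G.E e).codRestrict _ (G.E_mem e)

/-- The map `r_e ∘ s_e⁻¹ ∘ E_e : A_{s(e)} → A_{r(e)}`. -/
noncomputable def transfer {p q : V} (e : p ⟶ q) : G.A p →ₗ[ℂ] G.A q :=
  (G.r e).toAlgHom.toLinearMap ∘ₗ G.sInvE e

variable {p q : V} (e : p ⟶ q)

lemma s_sInvE (a : G.A p) : G.s e (G.sInvE e a) = G.E e a :=
  congrArg Subtype.val (LinearEquiv.apply_symm_apply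
    (LinearEquiv.ofInjective (G.s e).toAlgHom.toLinearMap (G.s_injective e)) _)

lemma transfer_apply (a : G.A p) : G.transfer e a = G.r e (G.sInvE e a) := rfl

lemma sInvE_E (a : G.A p) : G.sInvE e (G.E e a) = G.sInvE e a := by
  apply G.s_injective e
  rw [s_sInvE, s_sInvE]
  obtain ⟨b, hb⟩ := G.E_mem e a
  rw [← hb, G.E_apply_s]

lemma E_E (a : G.A p) : G.E e (G.E e a) = G.E e a := by
  obtain ⟨b, hb⟩ := G.E_mem e a
  rw [← hb, G.E_apply_s]

lemma sInvE_left (b : G.B e) (a : G.A p) : G.sInvE e (G.s e b * a) = b * G.sInvE e a := by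
  apply G.s_injective e
  rw [s_sInvE, G.E_left, map_mul, s_sInvE]

lemma sInvE_right (b : G.B e) (a : G.A p) : G.sInvE e (a * G.s e b) = G.sInvE e a * b := by
  apply G.s_injective e
  rw [s_sInvE, G.E_right, map_mul, s_sInvE]

lemma E_nonneg {a : G.A p} (ha : 0 ≤ a) : 0 ≤ G.E e a := by
  obtain ⟨b, rfl⟩ := CStarAlgebra.nonneg_iff_eq_star_mul_self.1 ha
  obtain ⟨c, hc⟩ := G.E_pos e b
  rw [hc]
  exact star_mul_self_nonneg c

lemma E_star (a : G.A p) : G.E e (star a) = star (G.E e a) :=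
  StarHomClass.map_star (PositiveLinearMap.mk₀ (G.E e) fun _ h => G.E_nonneg e h) a

lemma sInvE_star (a : G.A p) : G.sInvE e (star a) = star (G.sInvE e a) := by
  apply G.s_injective e
  rw [s_sInvE, E_star, map_star, s_sInvE]

lemma E_one : G.E e 1 = 1 := by
  have := G.E_apply_s e 1
  rwa [map_one] at this

lemma transfer_one : G.transfer e 1 = 1 := by
  have : G.sInvE e 1 = 1 := by
    apply G.s_injective e
    rw [s_sInvE, E_one, map_one]
  rw [transfer_apply, this, map_one]

lemma transfer_star (a : G.A p) : G.transfer e (star a) = star (G.transfer e a) := by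
  rw [transfer_apply, sInvE_star, map_star, transfer_apply]

lemma transfer_E (a : G.A p) : G.transfer e (G.E e a) = G.transfer e a := by
  rw [transfer_apply, sInvE_E, transfer_apply]

lemma transfer_E_mul (a b : G.A p) :
    G.transfer e (G.E e a * b) = G.transfer e a * G.transfer e b := by
  rw [← s_sInvE, transfer_apply, sInvE_left, map_mul]; rfl

lemma transfer_mul_E (a b : G.A p) :
    G.transfer e (a * G.E e b) = G.transfer e a * G.transfer e b := by
  rw [← s_sInvE, transfer_apply, sInvE_right, map_mul]; rfl

/-- Elements of `r_e(B_e)` are in the multiplicative domain of `E_ē`. -/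
lemma E_reverse_transfer (a : G.A p) :
    G.E (reverse e) (G.transfer e a) = G.transfer e a :=
  G.E_apply_s (reverse e) _

lemma E_reverse_transfer_mul (a : G.A p) (b : G.A q) :
    G.E (reverse e) (G.transfer e a * b) = G.transfer e a * G.E (reverse e) b :=
  G.E_left (reverse e) _ b

lemma E_reverse_mul_transfer (a : G.A p) (b : G.A q) :
    G.E (reverse e) (b * G.transfer e a) = G.E (reverse e) b * G.transfer e a :=
  G.E_right (reverse e) _ b

lemma transfer_reverse_transfer (a : G.A p) :
    G.transfer (reverse e) (G.transfer e a) = G.E e a := by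
  have h : G.sInvE (reverse e) (G.transfer e a) = G.bar e (G.sInvE e a) := by
    apply G.s_injective (reverse e)
    rw [s_sInvE, E_reverse_transfer]; rfl
  rw [transfer_apply, h]
  exact (G.s_bar_bar e _).trans (G.s_sInvE e a)

end GraphWithExpectations

/-! ### Positive definite kernels -/

/-- A finite hermitian matrix over a C⋆-algebra with positive quadratic form. -/
def IsPosKernel {I A : Type*} [Fintype I] [CStarAlgebra A] [PartialOrder A] (K : I → I → A) : Prop :=
  (∀ i j, star (K i j) = K j i) ∧ ∀ c : I → A, 0 ≤ ∑ i, ∑ j, star (c i) * K i j * c j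

section PosKernel

variable {I A B C : Type*} [Fintype I] [CStarAlgebra A] [PartialOrder A] [StarOrderedRing A]
  [CStarAlgebra B] [PartialOrder B] [StarOrderedRing B]

lemma exists_conj_negPart {M : Type*} [CStarAlgebra M] (N : M) (hsa : IsSelfAdjoint N) :
    ∃ T Y : M, T = star Y * Y ∧ star (Y * T) * (Y * T) = -(star T * N * T) ∧
      (Y * T = 0 → ∃ S, N = star S * S) := by
  let _ : PartialOrder M := CStarAlgebra.spectralOrder _
  have _ : StarOrderedRing M := CStarAlgebra.spectralOrderedRing _
  have hT0 : 0 ≤ N⁻ := CFC.negPart_nonneg N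
  have hTsa : star N⁻ = N⁻ := (IsSelfAdjoint.of_nonneg hT0).star_eq
  obtain ⟨Y, hY⟩ := CStarAlgebra.nonneg_iff_eq_star_mul_self.1 hT0
  refine ⟨N⁻, Y, hY, ?_, fun h => ?_⟩
  · have h1 : N = N⁺ - N⁻ := (CFC.posPart_sub_negPart N hsa).symm
    have h2 : star N⁻ * N * N⁻ = -(N⁻ * N⁻ * N⁻) := by
      rw [hTsa]
      conv_lhs => enter [1, 2]; rw [h1]
      rw [mul_sub, CFC.negPart_mul_posPart, zero_sub, neg_mul]
    rw [h2, neg_neg, star_mul, hTsa, mul_assoc, ← mul_assoc (star Y), ← hY, mul_assoc]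
  · have h3 : star N⁻ * N⁻ = 0 := by
      rw [hTsa]
      conv_lhs => enter [1]; rw [hY]
      rw [mul_assoc, h, mul_zero]
    have h4 := (CStarRing.star_mul_self_eq_zero_iff N⁻).1 h3
    exact CStarAlgebra.nonneg_iff_eq_star_mul_self.1 ((CFC.negPart_eq_zero_iff N hsa).1 h4)

lemma IsPosKernel.exists_eq {K : I → I → A} (hK : IsPosKernel K) :
    ∃ S : I → I → A, ∀ i j, K i j = ∑ k, star (S k i) * S k j := by
  classical
  let N : CStarMatrix I I A := CStarMatrix.ofMatrix (Matrix.of K)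
  have hN : ∀ i j, N i j = K i j := fun _ _ => rfl
  have hsa : IsSelfAdjoint N := by
    ext i j
    rw [CStarMatrix.star_apply, hN, hN, hK.1]
  obtain ⟨T, Y, hY, hYT, hpos⟩ := exists_conj_negPart N hsa
  have hR0 : Y * T = 0 := by
    ext k j
    have h1 : 0 ≤ (star T * N * T) j j := by
      have := hK.2 fun i => T i j
      refine this.trans_eq ?_
      simp only [CStarMatrix.mul_apply, CStarMatrix.star_apply, Finset.sum_mul, hN]
      exact Finset.sum_comm
    rw [← neg_eq_iff_eq_neg.2 hYT, CStarMatrix.neg_apply, CStarMatrix.mul_apply] at h1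
    have h2 : ∀ k ∈ Finset.univ, 0 ≤ star (Y * T) j k * (Y * T) k j := fun k _ => by
      rw [CStarMatrix.star_apply]; exact star_mul_self_nonneg _
    have h3 : ∑ k, star (Y * T) j k * (Y * T) k j = 0 :=
      le_antisymm (neg_nonneg.1 h1) (Finset.sum_nonneg h2)
    have h4 := (Finset.sum_eq_zero_iff_of_nonneg h2).1 h3 k (Finset.mem_univ _)
    rw [CStarMatrix.star_apply] at h4
    simpa using h4
  obtain ⟨S, hS⟩ := hpos hR0
  refine ⟨S, fun i j => ?_⟩
  rw [← hN, hS, CStarMatrix.mul_apply]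
  simp only [CStarMatrix.star_apply]

lemma IsPosKernel.of_eq {J : Type*} [Fintype J] {K : I → I → A} (S : J → I → A)
    (h : ∀ i j, K i j = ∑ k, star (S k i) * S k j) : IsPosKernel K := by
  refine ⟨fun i j => ?_, fun c => ?_⟩
  · simp [h, star_sum]
  · have : ∑ i, ∑ j, star (c i) * K i j * c j
        = ∑ k, star (∑ i, S k i * c i) * ∑ j, S k j * c j := by
      simp only [h, star_sum, star_mul, Finset.sum_mul, Finset.mul_sum, mul_assoc]
      rw [Finset.sum_congr rfl fun i _ => Finset.sum_comm, Finset.sum_comm]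
      refine Finset.sum_congr rfl fun k _ => ?_
      first | rfl | exact Finset.sum_comm
    rw [this]
    exact Finset.sum_nonneg fun k _ => star_mul_self_nonneg _

lemma IsPosKernel.map {K : I → I → A} (hK : IsPosKernel K) (f : A →⋆ₐ[ℂ] B) :
    IsPosKernel fun i j => f (K i j) := by
  obtain ⟨S, hS⟩ := hK.exists_eq
  refine .of_eq (fun k i => f (S k i)) fun i j => ?_
  rw [hS, map_sum]
  simp [map_mul, map_star]

lemma IsPosKernel.conj {K : I → I → A} (hK : IsPosKernel K) (a : I → A) :
    IsPosKernel fun i j => star (a i) * K i j * a j := by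
  refine ⟨fun i j => ?_, fun c => ?_⟩
  · simp [hK.1, mul_assoc]
  · refine (hK.2 fun i => a i * c i).trans_eq ?_
    simp [mul_assoc]

lemma IsPosKernel.subtype {K : I → I → A} (hK : IsPosKernel K) (s : I → Prop) [DecidablePred s] :
    IsPosKernel fun i j : {i // s i} => K i j := by
  refine ⟨fun i j => hK.1 i j, fun c => ?_⟩
  refine (hK.2 fun i => if h : s i then c ⟨i, h⟩ else 0).trans_eq ?_
  have : ∀ g : I → A, (∀ i, ¬ s i → g i = 0) → ∑ i, g i = ∑ i : {i // s i}, g i := by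
    intro g hg
    rw [← Finset.sum_filter_of_ne (p := s) fun i _ h => by by_contra h'; exact h (hg i h')]
    exact Finset.sum_subtype _ (by simp) g
  rw [this]
  · refine Finset.sum_congr rfl fun i _ => ?_
    rw [this]
    · refine Finset.sum_congr rfl fun j _ => ?_
      simp [i.2, j.2]
    · intro j hj; simp [hj]
  · intro i hi; simp [hi]

lemma sum_nonneg_of_blocks {H : Type*} (f : I → H) (g : I → I → A) [DecidableEq H]
    (hg : ∀ i j, f i ≠ f j → g i j = 0)
    (hb : ∀ h, 0 ≤ ∑ i : {i // f i = h}, ∑ j : {j // f j = h}, g i j) :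
    0 ≤ ∑ i, ∑ j, g i j := by
  rw [← Finset.sum_fiberwise_of_maps_to (s := Finset.univ) (t := Finset.univ.image f) (g := f)
    (fun i _ => Finset.mem_image_of_mem f (Finset.mem_univ i))]
  refine Finset.sum_nonneg fun h _ => (hb h).trans_eq ?_
  have e1 : ∀ k : I → A, ∑ i : {i // f i = h}, k i = ∑ i with f i = h, k i := fun k =>
    (Finset.sum_subtype _ (by simp) k).symm
  rw [e1 fun i => ∑ j : {j // f j = h}, g i j]
  refine Finset.sum_congr rfl fun i hi => ?_
  rw [e1]
  refine Finset.sum_filter_of_ne fun j _ hj => ?_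
  by_contra hne
  exact hj (hg i j fun h' => hne (h' ▸ (Finset.mem_filter.1 hi).2))

lemma StarAlgHom.nonneg_of_injective {f : A →⋆ₐ[ℂ] B} (hf : Function.Injective f) {a : A}
    (h : 0 ≤ f a) : 0 ≤ a := by
  have hsa : IsSelfAdjoint a := by
    apply hf
    rw [map_star, (IsSelfAdjoint.of_nonneg h).star_eq]
  rw [StarOrderedRing.nonneg_iff_spectrum_nonneg (R := ℝ) a hsa]
  rw [StarOrderedRing.nonneg_iff_spectrum_nonneg (R := ℝ) (f a), hsa.map_spectrum_real f hf] at h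
  exact h

end PosKernel

namespace GraphWithExpectations

variable {V : Type u} [Quiver.{v} V] [Quiver.HasInvolutiveReverse V]
  (G : GraphWithExpectations.{u, v, w, w'} V)

lemma isPosKernel_transfer {p q : V} (e : p ⟶ q) {I : Type*} [Fintype I] {K : I → I → G.A p}
    (hK : IsPosKernel K) : IsPosKernel fun i j => G.transfer e (K i j) := by
  let _ : PartialOrder (G.B e) := CStarAlgebra.spectralOrder _
  have _ : StarOrderedRing (G.B e) := CStarAlgebra.spectralOrderedRing _
  refine IsPosKernel.map (K := fun i j => G.sInvE e (K i j)) ⟨fun i j => ?_, fun c => ?_⟩ (G.r e)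
  · rw [← sInvE_star, hK.1]
  · apply StarAlgHom.nonneg_of_injective (G.s_injective e)
    have h := G.E_nonneg e (hK.2 fun i => G.s e (c i))
    convert h using 1
    simp only [map_sum]
    refine Finset.sum_congr rfl fun i _ => Finset.sum_congr rfl fun j _ => ?_
    rw [map_mul, map_mul, map_star, s_sInvE, ← map_star, G.E_right, G.E_left]

end GraphWithExpectations

/-! ### Path Hilbert modules -/

/-- An expression `a₀ e₁ a₁ ⋯ eₙ aₙ`, where `(e₁, …, eₙ)` is a path from `q` to `p`, `a₀ ∈ A_q` and
`aᵢ ∈ A_{r(eᵢ)}`. It is used both for the operator `a₀ u_{e₁} a₁ ⋯ u_{eₙ} aₙ` and for the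
elementary tensor `â₀ ⊗ ⋯ ⊗ âₙ₋₁ ⊗ aₙ`. -/
inductive Word {V : Type u} [Quiver.{v} V] [Quiver.HasInvolutiveReverse V]
    (G : GraphWithExpectations.{u, v, w, w'} V) : V → V → Type (max u v w)
  | nil {p : V} (a : G.A p) : Word G p p
  | cons {q x p : V} (e : q ⟶ x) (a : G.A q) (t : Word G x p) : Word G q p

namespace Word

variable {V : Type u} [Quiver.{v} V] [Quiver.HasInvolutiveReverse V]
  {G : GraphWithExpectations.{u, v, w, w'} V}

/-- The number of edges. -/
def length : ∀ {q p : V}, Word G q p → ℕ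
  | _, _, nil _ => 0
  | _, _, cons _ _ t => t.length + 1

open Classical in
/-- If the first edge of the word is `e`, the pair formed by the first letter and by the rest of
the word after `e`. -/
noncomputable def split? : ∀ {q p x : V}, Word G q p → (q ⟶ x) → Option (G.A q × Word G x p)
  | _, _, _, nil _, _ => none
  | q, _, x, cons (x := y) e a t, f =>
      if h : (⟨y, e⟩ : Σ z, q ⟶ z) = ⟨x, f⟩ then some (a, (Sigma.mk.inj_iff.1 h).1 ▸ t) else none

/-- The first edge of a word. -/
def head? : ∀ {q p : V}, Word G q p → Option (Σ x, q ⟶ x)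
  | _, _, nil _ => none
  | _, _, cons (x := x) e _ _ => some ⟨x, e⟩

@[simp] lemma split?_nil {p x : V} (a : G.A p) (f : p ⟶ x) : (nil a).split? f = none := rfl

@[simp] lemma split?_cons_self {q x p : V} (e : q ⟶ x) (a : G.A q) (t : Word G x p) :
    (cons e a t).split? e = some (a, t) := by
  simp [split?]

lemma eq_cons_of_split? {q x p : V} {t : Word G q p} {f : q ⟶ x} {a : G.A q} {t' : Word G x p}
    (h : t.split? f = some (a, t')) : t = cons f a t' := by
  cases t with
  | nil b => simp at h
  | cons e b t =>
    rw [split?] at h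
    split_ifs at h with h'
    cases h'
    simp only [Option.some.injEq, Prod.mk.injEq] at h
    rw [h.1, ← h.2]

lemma split?_cons_of_ne {q x y p : V} {e : q ⟶ x} {f : q ⟶ y} {a : G.A q} {t : Word G x p}
    (h : (⟨x, e⟩ : Σ z, q ⟶ z) ≠ ⟨y, f⟩) : (cons e a t).split? f = none := by
  rw [split?, dif_neg h]

/-- The condition at a backtracking: if the path of `t` starts with `ē`, then the first letter of
`t` is in the kernel of `E_ē`. -/
def ReducedAfter {q x p : V} (e : q ⟶ x) (t : Word G x p) : Prop :=
  ∀ a t', t.split? (reverse e) = some (a, t') → G.E (reverse e) a = 0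

/-- A word `a₀ e₁ a₁ ⋯ eₙ aₙ` is reduced if, for all `1 ≤ i < n` such that `eᵢ₊₁ = ēᵢ`, one has
`E_{eᵢ₊₁}(aᵢ) = 0`. -/
def Reduced : ∀ {q p : V}, Word G q p → Prop
  | _, _, nil _ => True
  | _, _, cons e _ t => t.ReducedAfter e ∧ t.Reduced

/-- Left multiplication of the first letter. -/
def lmul : ∀ {q p : V}, G.A q → Word G q p → Word G q p
  | _, _, b, nil a => nil (b * a)
  | _, _, b, cons e a t => cons e (b * a) t

/-- Right multiplication of the last letter. -/
def rmul : ∀ {q p : V}, Word G q p → G.A p → Word G q p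
  | _, _, nil a, b => nil (a * b)
  | _, _, cons e a t, b => cons e a (t.rmul b)

/-- The value `⟨ξ, x η⟩ ∈ A_p` of the inner product of the path Hilbert modules on elementary
tensors `ξ = â₀ ⊗ ⋯ ⊗ aₙ`, `η = b̂₀ ⊗ ⋯ ⊗ bₙ` over the same path, where `x` acts on the left. It is
`xₙ`, where `x₀ = a₀* x b₀` and `x_k = a_k* (r_{e_k} ∘ s_{e_k}⁻¹ ∘ E_{e_k}) (x_{k-1}) b_k`. Tensors
over different paths are orthogonal. -/
noncomputable def form : ∀ {q p : V}, Word G q p → Word G q p → G.A q → G.A p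
  | _, _, nil a, nil b, x => star a * x * b
  | _, _, nil _, cons _ _ _, _ => 0
  | _, _, cons e a t, t', x =>
    match t'.split? e with
    | some (b, t'') => t.form t'' (G.transfer e (star a * x * b))
    | none => 0

@[simp] lemma form_nil_nil {p : V} (a b x : G.A p) : (nil a).form (nil b) x = star a * x * b := rfl

lemma form_cons_of_none {q p x : V} {e : q ⟶ x} {a : G.A q} {t : Word G x p} {t' : Word G q p}
    (h : t'.split? e = none) (z : G.A q) : (cons e a t).form t' z = 0 := by
  rw [form, h]

@[simp] lemma form_cons_cons {q p x : V} (e : q ⟶ x) (a b : G.A q) (t t' : Word G x p)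
    (z : G.A q) :
    (cons e a t).form (cons e b t') z = t.form t' (G.transfer e (star a * z * b)) := by
  rw [form, split?_cons_self]

lemma form_add {q p : V} (t t' : Word G q p) (x y : G.A q) :
    t.form t' (x + y) = t.form t' x + t.form t' y := by
  induction t with
  | nil a => cases t' with
    | nil b => simp [mul_add, add_mul]
    | cons => simp [form]
  | cons e a t ih =>
    rcases h : t'.split? e with _ | ⟨b, t''⟩
    · simp [form_cons_of_none h]
    · rw [eq_cons_of_split? h]; simp [mul_add, add_mul, ih]

lemma form_smul {q p : V} (t t' : Word G q p) (c : ℂ) (x : G.A q) :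
    t.form t' (c • x) = c • t.form t' x := by
  induction t with
  | nil a => cases t' with
    | nil b => simp
    | cons => simp [form]
  | cons e a t ih =>
    rcases h : t'.split? e with _ | ⟨b, t''⟩
    · simp [form_cons_of_none h]
    · rw [eq_cons_of_split? h]; simp [ih]

@[simp] lemma form_zero {q p : V} (t t' : Word G q p) : t.form t' 0 = 0 := by
  simpa using form_smul t t' 0 0

lemma form_sub {q p : V} (t t' : Word G q p) (x y : G.A q) :
    t.form t' (x - y) = t.form t' x - t.form t' y := by
  rw [sub_eq_add_neg, form_add, ← neg_one_smul ℂ, form_smul, neg_one_smul, sub_eq_add_neg]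

lemma form_comm_of_none {q p x : V} {e : q ⟶ x} {a : G.A q} {t : Word G x p} {t' : Word G q p}
    (h : t'.split? e = none) (z : G.A q) : t'.form (cons e a t) z = 0 := by
  cases t' with
  | nil b => simp [form]
  | cons f b t' =>
    apply form_cons_of_none
    apply split?_cons_of_ne
    intro h'
    cases h'
    simp at h

lemma star_form {q p : V} (t t' : Word G q p) (x : G.A q) :
    star (t.form t' x) = t'.form t (star x) := by
  induction t with
  | nil a => cases t' with
    | nil b => simp [mul_assoc]
    | cons => simp [form]
  | cons e a t ih =>
    rcases h : t'.split? e with _ | ⟨b, t''⟩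
    · simp [form_cons_of_none h, form_comm_of_none h]
    · rw [eq_cons_of_split? h]; simp [ih, ← GraphWithExpectations.transfer_star, mul_assoc]

lemma split?_lmul {q p x : V} (c : G.A q) (t : Word G q p) (e : q ⟶ x) :
    (t.lmul c).split? e = (t.split? e).map fun y => (c * y.1, y.2) := by
  rcases h : t.split? e with _ | ⟨b, t''⟩
  · cases t with
    | nil => simp [lmul]
    | cons f b t =>
      rw [lmul, split?_cons_of_ne]; · rfl
      intro h'; cases h'; simp at h
  · rw [eq_cons_of_split? h]; simp [lmul]

lemma form_lmul_right {q p : V} (t t' : Word G q p) (c x : G.A q) :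
    t.form (t'.lmul c) x = t.form t' (x * c) := by
  cases t with
  | nil a => cases t' with
    | nil b => simp [lmul, mul_assoc]
    | cons => simp [form, lmul]
  | cons e a t =>
    rcases h : t'.split? e with _ | ⟨b, t''⟩
    · rw [form_cons_of_none h, form_cons_of_none]
      rw [split?_lmul, h]; rfl
    · rw [eq_cons_of_split? h]; simp [lmul, mul_assoc]

lemma form_lmul_left {q p : V} (t t' : Word G q p) (c x : G.A q) :
    (t.lmul c).form t' x = t.form t' (star c * x) := by
  rw [← star_star ((t.lmul c).form t' x), star_form, form_lmul_right, star_form]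
  simp

lemma split?_rmul {q p x : V} (c : G.A p) (t : Word G q p) (e : q ⟶ x) :
    (t.rmul c).split? e = (t.split? e).map fun y => (y.1, y.2.rmul c) := by
  rcases h : t.split? e with _ | ⟨b, t''⟩
  · cases t with
    | nil => simp [rmul]
    | cons f b t =>
      rw [rmul, split?_cons_of_ne]; · rfl
      intro h'; cases h'; simp at h
  · rw [eq_cons_of_split? h]; simp [rmul]

lemma form_rmul_right {q p : V} (t t' : Word G q p) (c : G.A p) (x : G.A q) :
    t.form (t'.rmul c) x = t.form t' x * c := by
  induction t with
  | nil a => cases t' with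
    | nil b => simp [rmul, mul_assoc]
    | cons => simp [form, rmul]
  | cons e a t ih =>
    rcases h : t'.split? e with _ | ⟨b, t''⟩
    · rw [form_cons_of_none h, form_cons_of_none, zero_mul]
      rw [split?_rmul, h]; rfl
    · rw [eq_cons_of_split? h]; simp [rmul, ih]

lemma ReducedAfter.rmul {q x p : V} {e : q ⟶ x} {t : Word G x p} (h : t.ReducedAfter e)
    (c : G.A p) : (t.rmul c).ReducedAfter e := by
  intro a t' h'
  rw [split?_rmul] at h'
  rcases h'' : t.split? (reverse e) with _ | ⟨b, t''⟩
  · simp [h''] at h'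
  · simp only [h'', Option.map_some, Option.some.injEq, Prod.mk.injEq] at h'
    rw [← h'.1]; exact h _ _ h''

lemma Reduced.rmul {q p : V} {t : Word G q p} (h : t.Reduced) (c : G.A p) :
    (t.rmul c).Reduced := by
  induction t with
  | nil => trivial
  | cons e a t ih => exact ⟨h.1.rmul c, ih h.2 c⟩

lemma Reduced.lmul {q p : V} {t : Word G q p} (h : t.Reduced) (c : G.A q) :
    (t.lmul c).Reduced := by
  cases t with
  | nil => trivial
  | cons e a t => exact h

lemma Reduced.cons_one {q x p : V} {e : q ⟶ x} {t : Word G x p} (h : t.Reduced)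
    (h' : t.split? (reverse e) = none) : (cons e 1 t).Reduced :=
  ⟨fun a t' h'' => by simp [h'] at h'', h⟩

lemma Reduced.cons_one_cons {q x p : V} {e : q ⟶ x} {b : G.A x} {t : Word G q p}
    (h : (cons (reverse e) b t).Reduced) :
    (cons e 1 (cons (reverse e) (b - G.E (reverse e) b) t)).Reduced := by
  refine ⟨fun a t' h' => ?_, h⟩
  simp only [split?_cons_self, Option.some.injEq, Prod.mk.injEq] at h'
  rw [← h'.1, map_sub, G.E_E, sub_self]

/-- Positivity of the inner product on elementary tensors. -/
lemma isPosKernel_form (n : ℕ) : ∀ {q p : V} {I : Type*} [Fintype I] (t : I → Word G q p)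
    (_ : ∀ i, (t i).length < n) {K : I → I → G.A q} (_ : IsPosKernel K),
    IsPosKernel fun i j => (t i).form (t j) (K i j) := by
  classical
  induction n with
  | zero =>
    intro q p I _ t ht K hK
    exact ⟨fun i => absurd (ht i) (by simp),
      fun c => Finset.sum_nonneg fun i => absurd (ht i) (by simp)⟩
  | succ n ih =>
    intro q p I _ t ht K hK
    refine ⟨fun i j => by rw [star_form, hK.1], fun c => ?_⟩
    have head_eq : ∀ (t : Word G q p) (x : V) (e : q ⟶ x), t.head? = some ⟨x, e⟩ →
        ∃ a t', t = cons e a t' := by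
      intro t x e h
      cases t with
      | nil a => simp [head?] at h
      | cons f a t =>
        simp only [head?, Option.some.injEq] at h
        cases h
        exact ⟨a, t, rfl⟩
    refine sum_nonneg_of_blocks (fun i => (t i).head?) _ (fun i j hij => ?_) fun h => ?_
    · have : (t i).form (t j) (K i j) = 0 := by
        generalize t i = ti at hij ⊢
        generalize t j = tj at hij ⊢
        cases ti with
        | nil a => cases tj with
          | nil => exact absurd rfl hij
          | cons => simp [form]
        | cons e a t' =>
          apply form_cons_of_none
          rcases h : tj.split? e with _ | ⟨b, t''⟩
          · rfl
          · rw [eq_cons_of_split? h] at hij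
            exact absurd rfl hij
      simp only [this, mul_zero, zero_mul]
    · rcases h with _ | ⟨x, e⟩
      · have hnil : ∀ i : {i // (t i).head? = none}, ∃ hq : q = p, ∃ a : G.A q,
            t i = hq ▸ nil a := by
          rintro ⟨i, hi⟩
          change ∃ hq : q = p, ∃ a : G.A q, t i = hq ▸ nil a
          generalize t i = ti at hi ⊢
          cases ti with
          | nil a => exact ⟨rfl, a, rfl⟩
          | cons => simp [head?] at hi
        rcases isEmpty_or_nonempty {i // (t i).head? = none} with hem | ⟨⟨i₀⟩⟩
        · simp
        · obtain ⟨rfl, -⟩ := hnil i₀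
          have hnil' : ∀ i : {i // (t i).head? = none}, ∃ a : G.A q, t i = nil a := fun i => by
            obtain ⟨_, a, h⟩ := hnil i
            exact ⟨a, h⟩
          choose a ha using hnil'
          have := ((hK.subtype fun i => (t i).head? = none).conj a).2 fun i => c i
          simpa only [ha, form_nil_nil] using this
      · have hcons : ∀ i : {i // (t i).head? = some ⟨x, e⟩}, ∃ a t', t i = cons e a t' :=
          fun i => head_eq _ _ _ i.2
        choose a t' ht' using hcons
        have := (ih t' (fun i => by
          have := ht i
          rw [ht' i, length] at this
          omega) (G.isPosKernel_transfer e
            ((hK.subtype fun i => (t i).head? = some ⟨x, e⟩).conj a))).2 fun i => c i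
        simpa only [ht', form_cons_cons] using this

end Word

namespace GraphWithExpectations

open Word

section PathSpace

variable {V : Type u} [Quiver.{v} V] [Quiver.HasInvolutiveReverse V]
  (G : GraphWithExpectations.{u, v, w, w'} V)

/-- The complex vector space freely spanned by the elementary tensors
`â₀ ⊗ ⋯ ⊗ âₙ₋₁ ⊗ aₙ` over all paths `(e₁, …, eₙ)` from `q` to `p`, where `aᵢ` is in the kernel
of `E_{eᵢ₊₁}` whenever `eᵢ₊₁ = ēᵢ`. -/
def PathSpace (q p : V) : Type max u v w := {t : Word G q p // t.Reduced} →₀ ℂ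

noncomputable instance (q p : V) : AddCommGroup (G.PathSpace q p) :=
  inferInstanceAs (AddCommGroup ({t : Word G q p // t.Reduced} →₀ ℂ))

noncomputable instance (q p : V) : Module ℂ (G.PathSpace q p) :=
  inferInstanceAs (Module ℂ ({t : Word G q p // t.Reduced} →₀ ℂ))

variable {G} {q p x : V}

/-- The elementary tensor given by a reduced word. -/
noncomputable def ofWord (t : Word G q p) (h : t.Reduced) : G.PathSpace q p :=
  Finsupp.single ⟨t, h⟩ 1

/-- Linear extension of a map defined on elementary tensors. -/
noncomputable def liftWord {M : Type*} [AddCommGroup M] [Module ℂ M]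
    (f : {t : Word G q p // t.Reduced} → M) : G.PathSpace q p →ₗ[ℂ] M :=
  Finsupp.linearCombination ℂ f

@[simp] lemma liftWord_ofWord {M : Type*} [AddCommGroup M] [Module ℂ M]
    (f : {t : Word G q p // t.Reduced} → M) (t : Word G q p) (h : t.Reduced) :
    liftWord f (ofWord t h) = f ⟨t, h⟩ := by
  exact (Finsupp.linearCombination_single ℂ _ _).trans (one_smul _ _)

lemma pathSpace_induction {P : G.PathSpace q p → Prop} (h0 : P 0)
    (ha : ∀ x y, P x → P y → P (x + y)) (hw : ∀ (c : ℂ) t h, P (c • ofWord t h))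
    (x : G.PathSpace q p) : P x := by
  refine Finsupp.induction_linear (motive := P) x h0 ha fun t c => ?_
  have := hw c t.1 t.2
  have e : (c • ofWord t.1 t.2 : G.PathSpace q p) = Finsupp.single t c :=
    (Finsupp.smul_single _ _ _).trans (by simp)
  rwa [e] at this

/-- The linear form `y ↦ ⟨t, z y⟩`. -/
noncomputable def ipr (t : Word G q p) (z : G.A q) : G.PathSpace q p →ₗ[ℂ] G.A p :=
  liftWord fun t' => t.form t'.1 z

/-- The sesquilinear form `⟨x, z y⟩` on the span of the elementary tensors. -/
noncomputable def ip (z : G.A q) (x y : G.PathSpace q p) : G.A p :=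
  Finsupp.sum x fun t c => star c • ipr t.1 z y

lemma ip_add_right (z : G.A q) (x y y' : G.PathSpace q p) :
    ip z x (y + y') = ip z x y + ip z x y' := by
  simp only [ip, map_add, smul_add]; exact Finsupp.sum_add

lemma ip_smul_right (z : G.A q) (x y : G.PathSpace q p) (c : ℂ) :
    ip z x (c • y) = c • ip z x y := by
  simp only [ip, map_smul]
  exact (Finsupp.sum_congr fun t _ => smul_comm _ _ _).trans Finsupp.smul_sum.symm

lemma ip_add_left (z : G.A q) (x x' y : G.PathSpace q p) :
    ip z (x + x') y = ip z x y + ip z x' y :=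
  Finsupp.sum_add_index' (by simp) (by simp [add_smul])

lemma ip_smul_left (z : G.A q) (x y : G.PathSpace q p) (c : ℂ) :
    ip z (c • x) y = star c • ip z x y := by
  refine (Finsupp.sum_smul_index' (by simp)).trans ?_
  simp only [smul_eq_mul, star_mul', mul_smul]
  exact Finsupp.smul_sum.symm

lemma ip_zero_left (z : G.A q) (y : G.PathSpace q p) : ip z 0 y = 0 :=
  Finsupp.sum_zero_index

lemma ip_zero_right (z : G.A q) (x : G.PathSpace q p) : ip z x 0 = 0 := by
  simpa using ip_smul_right z x 0 0

lemma ip_ofWord_left (z : G.A q) (t : Word G q p) (h : t.Reduced) (y : G.PathSpace q p) :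
    ip z (ofWord t h) y = ipr t z y :=
  (Finsupp.sum_single_index (by simp)).trans (by simp)

lemma ip_ofWord (z : G.A q) (t t' : Word G q p) (h : t.Reduced) (h' : t'.Reduced) :
    ip z (ofWord t h) (ofWord t' h') = t.form t' z := by
  rw [ip_ofWord_left, ipr, liftWord_ofWord]

/-- Maps which are conjugate linear in the first and linear in the second variable. -/
structure IsSesq {X Y Z : Type*} [AddCommGroup X] [Module ℂ X] [AddCommGroup Y] [Module ℂ Y]
    [AddCommGroup Z] [Module ℂ Z] (F : X → Y → Z) : Prop where
  add_left : ∀ x x' y, F (x + x') y = F x y + F x' y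
  add_right : ∀ x y y', F x (y + y') = F x y + F x y'
  smul_left : ∀ (c : ℂ) x y, F (c • x) y = star c • F x y
  smul_right : ∀ (c : ℂ) x y, F x (c • y) = c • F x y

lemma isSesq_ip (z : G.A q) : IsSesq (ip (p := p) z) :=
  ⟨ip_add_left z, ip_add_right z, fun c x y => ip_smul_left z x y c,
    fun c x y => ip_smul_right z x y c⟩

lemma IsSesq.comp {X X' Y Y' Z Z' : Type*} [AddCommGroup X] [Module ℂ X] [AddCommGroup Y]
    [Module ℂ Y] [AddCommGroup Z] [Module ℂ Z] [AddCommGroup X'] [Module ℂ X'] [AddCommGroup Y']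
    [Module ℂ Y'] [AddCommGroup Z'] [Module ℂ Z'] {F : X → Y → Z} (hF : IsSesq F) (f : X' →ₗ[ℂ] X)
    (g : Y' →ₗ[ℂ] Y) (h : Z →ₗ[ℂ] Z') : IsSesq fun x y => h (F (f x) (g y)) :=
  ⟨fun x x' y => by simp only [map_add, hF.add_left],
    fun x y y' => by simp only [map_add, hF.add_right],
    fun c x y => by simp only [map_smul, hF.smul_left],
    fun c x y => by simp only [map_smul, hF.smul_right]⟩

lemma ip_ext {q' : V} {Z : Type*} [AddCommGroup Z] [Module ℂ Z]
    {F H : G.PathSpace q p → G.PathSpace q' p → Z} (hF : IsSesq F) (hH : IsSesq H)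
    (h : ∀ t ht t' ht', F (ofWord t ht) (ofWord t' ht') = H (ofWord t ht) (ofWord t' ht'))
    (x : G.PathSpace q p) (y : G.PathSpace q' p) : F x y = H x y := by
  induction x using pathSpace_induction with
  | h0 => rw [← zero_smul ℂ (0 : G.PathSpace q p), hF.smul_left, hH.smul_left]; simp
  | ha a b ha hb => rw [hF.add_left, hH.add_left, ha, hb]
  | hw c t ht =>
    rw [hF.smul_left, hH.smul_left]
    congr 1
    induction y using pathSpace_induction with
    | h0 => rw [← zero_smul ℂ (0 : G.PathSpace q' p), hF.smul_right, hH.smul_right]; simp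
    | ha a b ha hb => rw [hF.add_right, hH.add_right, ha, hb]
    | hw d t' ht' => rw [hF.smul_right, hH.smul_right, h]

lemma star_ip (z : G.A q) (x y : G.PathSpace q p) : star (ip z x y) = ip (star z) y x := by
  refine ip_ext (F := fun x y => ip z x y) (H := fun x y => star (ip (star z) y x)) (isSesq_ip z)
    ⟨fun x x' y => ?_, fun x y y' => ?_, fun c x y => ?_, fun c x y => ?_⟩
    (fun t ht t' ht' => ?_) x y ▸ star_star _
  · rw [ip_add_right, star_add]
  · rw [ip_add_left, star_add]
  · rw [ip_smul_right, star_smul]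
  · rw [ip_smul_left, star_smul, star_star]
  · rw [ip_ofWord, ip_ofWord, star_form, star_star]

lemma ip_sub (z z' : G.A q) (x y : G.PathSpace q p) : ip (z - z') x y = ip z x y - ip z' x y := by
  refine ip_ext (F := ip (z - z')) (H := fun x y => ip z x y - ip z' x y) (isSesq_ip _)
    ⟨fun x x' y => ?_, fun x y y' => ?_, fun c x y => ?_, fun c x y => ?_⟩
    (fun t ht t' ht' => by simp only [ip_ofWord, form_sub]) x y
  · rw [ip_add_left, ip_add_left]; abel
  · rw [ip_add_right, ip_add_right]; abel
  · rw [ip_smul_left, ip_smul_left, smul_sub]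
  · rw [ip_smul_right, ip_smul_right, smul_sub]

lemma ip_smul (c : ℂ) (z : G.A q) (x y : G.PathSpace q p) : ip (c • z) x y = c • ip z x y :=
  ip_ext (isSesq_ip _) ((isSesq_ip z).comp .id .id (c • .id))
    (fun t ht t' ht' => by
      simp only [ip_ofWord, form_smul, LinearMap.id_coe, id_eq, LinearMap.smul_apply]) x y

lemma ip_self_nonneg {z : G.A q} (hz : 0 ≤ z) (x : G.PathSpace q p) : 0 ≤ ip z x x := by
  obtain ⟨s, rfl⟩ := CStarAlgebra.nonneg_iff_eq_star_mul_self.1 hz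
  let x' : {t : Word G q p // t.Reduced} →₀ ℂ := x
  have hK : IsPosKernel fun _ _ : x'.support => star s * s :=
    IsPosKernel.of_eq (J := Unit) (fun _ _ => s) (by simp)
  have h := (isPosKernel_form (x'.support.sup (fun t => t.1.length) + 1)
    (fun t : x'.support => t.1.1)
    (fun t => Nat.lt_succ_of_le (Finset.le_sup (f := fun t : {t : Word G q p // t.Reduced} =>
      t.1.length) t.2)) hK).2 fun t => algebraMap ℂ (G.A p) (x' t)
  refine h.trans_eq ?_
  have e1 : ip (star s * s) x x = ∑ t ∈ x'.support, ∑ t' ∈ x'.support,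
      star (algebraMap ℂ (G.A p) (x' t)) * t.1.form t'.1 (star s * s)
        * algebraMap ℂ (G.A p) (x' t') := by
    change ∑ t ∈ x'.support, star (x' t) • ∑ t' ∈ x'.support, x' t' • t.1.form t'.1 _ = _
    refine Finset.sum_congr rfl fun t _ => ?_
    rw [Finset.smul_sum]
    refine Finset.sum_congr rfl fun t' _ => ?_
    simp only [Algebra.algebraMap_eq_smul_one, star_smul, star_one, smul_mul_assoc, one_mul,
      mul_smul_comm, mul_one]
    exact smul_comm _ _ _
  rw [e1, ← Finset.sum_coe_sort x'.support]
  refine Finset.sum_congr rfl fun t _ => ?_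
  rw [← Finset.sum_coe_sort x'.support]

/-- The right action of `A_p`, on the last letter. -/
noncomputable instance : SMul (G.A p)ᵐᵒᵖ (G.PathSpace q p) :=
  ⟨fun a x => liftWord (fun t => ofWord (t.1.rmul (unop a)) (t.2.rmul _)) x⟩

lemma op_smul_def (a : G.A p) (x : G.PathSpace q p) :
    op a • x = liftWord (fun t => ofWord (t.1.rmul a) (t.2.rmul _)) x := rfl

lemma ip_op_smul_right (z : G.A q) (a : G.A p) (x y : G.PathSpace q p) :
    ip z x (op a • y) = ip z x y * a := by
  refine ip_ext ((isSesq_ip z).comp .id (liftWord fun t => ofWord (t.1.rmul a) (t.2.rmul _)) .id)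
    ((isSesq_ip z).comp .id .id (LinearMap.mulRight ℂ a)) (fun t ht t' ht' => ?_) x y
  simp only [LinearMap.id_coe, id_eq, liftWord_ofWord, ip_ofWord, form_rmul_right,
    LinearMap.mulRight_apply]

/-- The semi-inner product `⟨x, y⟩ ∈ A_p` on the span of the elementary tensors. -/
noncomputable def pathCore (q p : V) : PreHilbertModuleCore (G.A p) (G.PathSpace q p) where
  inner := ip 1
  inner_add_right := ip_add_right 1
  inner_smul_right c x y := ip_smul_right 1 x y c
  inner_op_smul_right := ip_op_smul_right 1
  star_inner x y := by rw [star_ip, star_one]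
  inner_self_nonneg := ip_self_nonneg zero_le_one

noncomputable instance : SeminormedAddCommGroup (G.PathSpace q p) :=
  (pathCore q p).toSeminormedAddCommGroup
noncomputable instance : NormedSpace ℂ (G.PathSpace q p) :=
  (pathCore q p).toNormedSpace
noncomputable instance : PreHilbertModule (G.A p) (G.PathSpace q p) :=
  (pathCore q p).toPreHilbertModule

lemma inner_def (x y : G.PathSpace q p) : inner (G.A p) x y = ip 1 x y := rfl

end PathSpace

section PathModule

variable {V : Type u} [Quiver.{v} V] [Quiver.HasInvolutiveReverse V]
  (G : GraphWithExpectations.{u, v, w, w'} V)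

/-- The path Hilbert `A_p`-module `𝓗_{q,p}`: the Hilbert module generated by the elementary tensors
over all the paths from `q` to `p`. -/
abbrev PathModule (q p : V) : Type max u v w := Completion (G.PathSpace q p)

variable {G} {q p x : V}

lemma completion_isAdjointOp {y : V} (T : G.PathSpace q p →L[ℂ] G.PathSpace y p)
    (S : G.PathSpace y p →L[ℂ] G.PathSpace q p) (h : ∀ a b, ip 1 (T a) b = ip 1 a (S b)) :
    IsAdjointOp (G.A p) T.completion S.completion := fun a b => by
  refine Completion.induction_on₂ a b (isClosed_eq ?_ ?_) fun a b => ?_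
  · exact PreHilbertModule.completion_continuous_inner.comp
      ((T.completion.continuous.comp continuous_fst).prodMk continuous_snd)
  · exact PreHilbertModule.completion_continuous_inner.comp
      (continuous_fst.prodMk (S.completion.continuous.comp continuous_snd))
  · rw [ContinuousLinearMap.completion_apply_coe, ContinuousLinearMap.completion_apply_coe,
      PreHilbertModule.completion_inner_coe, PreHilbertModule.completion_inner_coe]
    exact h a b

end PathModule

end GraphWithExpectations

namespace GraphWithExpectations

open Word

section Operators

variable {V : Type u} [Quiver.{v} V] [Quiver.HasInvolutiveReverse V]
  {G : GraphWithExpectations.{u, v, w, w'} V} {q p x : V}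

/-- Left multiplication by `a ∈ A_q`, on the span of the elementary tensors. -/
noncomputable def preLeftAct (a : G.A q) : G.PathSpace q p →ₗ[ℂ] G.PathSpace q p :=
  liftWord fun t => ofWord (t.1.lmul a) (t.2.lmul a)

lemma ip_preLeftAct_right (z a : G.A q) (x y : G.PathSpace q p) :
    ip z x (preLeftAct a y) = ip (z * a) x y :=
  ip_ext ((isSesq_ip z).comp .id (preLeftAct a) .id) (isSesq_ip _) (fun t ht t' ht' => by
    simp only [preLeftAct, LinearMap.id_coe, id_eq, liftWord_ofWord, ip_ofWord, form_lmul_right])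
    x y

lemma ip_preLeftAct_left (z a : G.A q) (x y : G.PathSpace q p) :
    ip z (preLeftAct a x) y = ip (star a * z) x y :=
  ip_ext ((isSesq_ip z).comp (preLeftAct a) .id .id) (isSesq_ip _) (fun t ht t' ht' => by
    simp only [preLeftAct, LinearMap.id_coe, id_eq, liftWord_ofWord, ip_ofWord, form_lmul_left])
    x y

lemma norm_preLeftAct_le (a : G.A q) (x : G.PathSpace q p) :
    ‖preLeftAct a x‖ ≤ ‖a‖ * ‖x‖ := by
  refine PreHilbertModule.norm_le_of_inner_le (A := G.A p) (by positivity) ?_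
  rw [mul_pow, PreHilbertModule.norm_sq_eq (A := G.A p) x, inner_def, inner_def,
    ip_preLeftAct_right, ip_preLeftAct_left, one_mul]
  have h := CStarAlgebra.star_mul_le_algebraMap_norm_sq (a := a)
  have h2 := ip_self_nonneg (sub_nonneg.2 h) x
  rw [ip_sub, Algebra.algebraMap_eq_smul_one, ← Complex.coe_smul, ip_smul, sub_nonneg] at h2
  refine (CStarAlgebra.norm_le_norm_of_nonneg_of_le
    (ip_self_nonneg (star_mul_self_nonneg a) x) h2).trans_eq ?_
  rw [norm_smul, Complex.norm_real, norm_pow, norm_norm]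

/-- The left action of `A_q` on `𝓗_{q,p}`. -/
noncomputable def leftAct (p : V) (a : G.A q) : G.PathModule q p →L[ℂ] G.PathModule q p :=
  ((preLeftAct a).mkContinuous ‖a‖ (norm_preLeftAct_le a)).completion

lemma isAdjointOp_leftAct (a : G.A q) :
    IsAdjointOp (G.A p) (leftAct p a) (leftAct p (star a)) :=
  completion_isAdjointOp _ _ fun x y => by
    rw [LinearMap.mkContinuous_apply, LinearMap.mkContinuous_apply, ip_preLeftAct_right,
      ip_preLeftAct_left, one_mul, mul_one]

/-- The operator `u_e` on elementary tensors. It adds the edge `e` on the left; if the path of the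
tensor starts with `ē`, with first letter `a`, this is only done for the part `a - E_ē(a)` of `a`,
while the part `E_ē(a)` is moved through the edge. -/
noncomputable def edgeWord (e : q ⟶ x) (t : {t : Word G x p // t.Reduced}) : G.PathSpace q p :=
  match h : t.1.split? (reverse e) with
  | none => ofWord (cons e 1 t.1) (t.2.cons_one h)
  | some (a, t') =>
    have ht' : (cons (reverse e) a t').Reduced := eq_cons_of_split? h ▸ t.2
    ofWord (cons e 1 (cons (reverse e) (a - G.E (reverse e) a) t')) ht'.cons_one_cons +
      ofWord (t'.lmul (G.transfer (reverse e) a)) (ht'.2.lmul _)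

/-- The operator `u_e` on the span of the elementary tensors. -/
noncomputable def preEdgeOp (e : q ⟶ x) : G.PathSpace x p →ₗ[ℂ] G.PathSpace q p :=
  liftWord (edgeWord e)

lemma preEdgeOp_none {e : q ⟶ x} {f : x ⟶ q} (hf : f = reverse e) {t : Word G x p}
    (ht : t.Reduced) (h : t.split? f = none) :
    preEdgeOp e (ofWord t ht) = ofWord (cons e 1 t) (ht.cons_one (hf ▸ h)) := by
  subst hf
  rw [preEdgeOp, liftWord_ofWord, edgeWord]
  split
  · rfl
  · next h' => rw [h] at h'; cases h'

lemma preEdgeOp_cons {e : q ⟶ x} {f : x ⟶ q} (hf : f = reverse e) {a : G.A x} {t : Word G q p}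
    (ht : (cons f a t).Reduced) :
    ∃ h h', preEdgeOp e (ofWord (cons f a t) ht)
      = ofWord (cons e 1 (cons f (a - G.E f a) t)) h + ofWord (t.lmul (G.transfer f a)) h' := by
  subst hf
  refine ⟨ht.cons_one_cons, ht.2.lmul _, ?_⟩
  rw [preEdgeOp, liftWord_ofWord, edgeWord]
  split
  · next h' => simp at h'
  · next a' t' h' =>
    simp only [split?_cons_self, Option.some.injEq, Prod.mk.injEq] at h'
    obtain ⟨rfl, rfl⟩ := h'
    rfl

lemma transfer_kernel_left {e : q ⟶ x} {a : G.A q} (h : G.E e a = 0) (b : G.A x)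
    (c : G.A q) (f : x ⟶ q) (hf : e = reverse f) :
    G.transfer e (a * G.transfer f b * G.E e c) = 0 := by
  subst hf
  rw [G.transfer_mul_E, ← G.E_reverse_transfer f b, G.transfer_mul_E, ← G.transfer_E, h, map_zero,
    zero_mul, zero_mul]

lemma form_kernel {e : q ⟶ x} {f : x ⟶ q} (hf : e = reverse f) {t : Word G q p}
    (ht : t.ReducedAfter f) (c : G.A q) (s : Word G x p) (b : G.A x) :
    t.form (cons e (G.E e c) s) (G.transfer f b) = 0 := by
  subst hf
  rcases h : t.split? (reverse f) with _ | ⟨a, t'⟩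
  · exact form_comm_of_none h _
  · have h0 := ht a t' h
    rw [eq_cons_of_split? h, form_cons_cons, transfer_kernel_left _ _ _ f rfl, form_zero]
    rw [G.E_star, h0, star_zero]

lemma form_kernel' {e : q ⟶ x} {f : x ⟶ q} (hf : e = reverse f) {t : Word G q p}
    (ht : t.ReducedAfter f) (c : G.A q) (s : Word G x p) (b : G.A x) :
    (cons e (G.E e c) s).form t (G.transfer f b) = 0 := by
  rw [← star_star ((cons e (G.E e c) s).form t (G.transfer f b)), star_form, ← G.transfer_star,
    form_kernel hf ht, star_zero]

lemma form_cons_sub (e : q ⟶ x) (a b : G.A q) (t : Word G x p) (s : Word G q p) (z : G.A q) :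
    s.form (cons e (a - b) t) z = s.form (cons e a t) z - s.form (cons e b t) z := by
  rcases h : s.split? e with _ | ⟨c, s'⟩
  · simp [form_comm_of_none h]
  · rw [eq_cons_of_split? h]; simp [mul_sub, form_sub]

lemma form_cons_sub' (e : q ⟶ x) (a b : G.A q) (t : Word G x p) (s : Word G q p) (z : G.A q) :
    (cons e (a - b) t).form s z = (cons e a t).form s z - (cons e b t).form s z := by
  rcases h : s.split? e with _ | ⟨c, s'⟩
  · simp [form_cons_of_none h]
  · rw [eq_cons_of_split? h]; simp [sub_mul, form_sub]

lemma ip_preEdgeOp_ofWord {e : q ⟶ x} {f : x ⟶ q} (hf : f = reverse e) (he : e = reverse f)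
    {t : Word G x p} (ht : t.Reduced) {s : Word G q p} (hs : s.Reduced) :
    ip 1 (preEdgeOp e (ofWord t ht)) (ofWord s hs)
      = ip 1 (ofWord t ht) (preEdgeOp f (ofWord s hs)) := by
  rcases h : t.split? f with _ | ⟨b, t'⟩
  · rw [preEdgeOp_none hf ht h]
    rcases h' : s.split? e with _ | ⟨c, s'⟩
    · rw [preEdgeOp_none he hs h', ip_ofWord, ip_ofWord, form_cons_of_none h', form_comm_of_none h]
    · obtain rfl := eq_cons_of_split? h'
      obtain ⟨h1, h2, h3⟩ := preEdgeOp_cons he hs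
      rw [h3, ip_add_right, ip_ofWord, ip_ofWord, ip_ofWord, form_comm_of_none h, form_lmul_right,
        form_cons_cons]
      simp
  · obtain rfl := eq_cons_of_split? h
    obtain ⟨h1, h2, h3⟩ := preEdgeOp_cons hf ht
    rw [h3, ip_add_left, ip_ofWord, ip_ofWord]
    rcases h' : s.split? e with _ | ⟨c, s'⟩
    · rw [preEdgeOp_none he hs h', ip_ofWord, form_cons_of_none h', form_lmul_left, form_cons_cons,
        ← G.transfer_star]
      simp
    · obtain rfl := eq_cons_of_split? h'
      obtain ⟨h4, h5, h6⟩ := preEdgeOp_cons he hs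
      rw [h6, ip_add_right, ip_ofWord, ip_ofWord, form_lmul_left, form_lmul_right, form_cons_cons,
        form_cons_cons, form_cons_sub, form_cons_sub', ← G.transfer_star]
      simp only [star_one, one_mul, mul_one]
      have ht1 : t'.ReducedAfter f := ht.1
      have hs1 : s'.ReducedAfter e := hs.1
      rw [form_kernel he ht1, form_kernel' hf hs1]
      abel

lemma ip_preEdgeOp {e : q ⟶ x} {f : x ⟶ q} (hf : f = reverse e) (he : e = reverse f)
    (a : G.PathSpace x p) (b : G.PathSpace q p) :
    ip 1 (preEdgeOp e a) b = ip 1 a (preEdgeOp f b) :=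
  ip_ext ((isSesq_ip 1).comp (preEdgeOp e) .id .id) ((isSesq_ip 1).comp .id (preEdgeOp f) .id)
    (fun t ht s hs => by
      simp only [LinearMap.id_coe, id_eq]
      exact ip_preEdgeOp_ofWord hf he ht hs) a b

lemma form_zero_letter (e : q ⟶ x) (t : Word G x p) (s : Word G q p) (z : G.A q) :
    s.form (cons e 0 t) z = 0 := by
  simpa using form_cons_sub e 0 0 t s z

lemma form_zero_letter' {y : V} (f : y ⟶ q) (e : q ⟶ x) (t : Word G x p) (s : Word G y p)
    (z : G.A y) : s.form (cons f 1 (cons e 0 t)) z = 0 := by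
  rcases h : s.split? f with _ | ⟨c, s'⟩
  · simp [form_comm_of_none h]
  · rw [eq_cons_of_split? h, form_cons_cons, form_zero_letter]

lemma form_lmul_zero (t s : Word G q p) (z : G.A q) : s.form (t.lmul 0) z = 0 := by
  rw [form_lmul_right, mul_zero, form_zero]

lemma ip_preEdgeOp_preEdgeOp_ofWord {e : q ⟶ x} {f : x ⟶ q} (hf : f = reverse e)
    (he : e = reverse f) {t s : Word G x p} (ht : t.Reduced) (hs : s.Reduced) :
    ip 1 (ofWord s hs) (preEdgeOp f (preEdgeOp e (ofWord t ht)))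
      = ip 1 (ofWord s hs) (ofWord t ht) := by
  rcases h : t.split? f with _ | ⟨b, t'⟩
  · rw [preEdgeOp_none hf ht h]
    obtain ⟨h1, h2, h3⟩ := preEdgeOp_cons he (ht.cons_one (e := e) (hf ▸ h))
    rw [h3, ip_add_right, ip_ofWord, ip_ofWord, ip_ofWord, form_lmul_right, G.E_one, sub_self,
      G.transfer_one, form_zero_letter', mul_one, zero_add]
  · obtain rfl := eq_cons_of_split? h
    obtain ⟨h1, h2, h3⟩ := preEdgeOp_cons hf ht
    rw [h3, map_add, ip_add_right]
    obtain ⟨h4, h5, h6⟩ := preEdgeOp_cons he h1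
    have key : ip 1 (ofWord s hs) (preEdgeOp f (ofWord (t'.lmul (G.transfer f b)) h2))
        = s.form (cons f (G.E f b) t') 1 := by
      have h7 : s.form (cons f 1 (t'.lmul (G.transfer f b))) 1 = s.form (cons f (G.E f b) t') 1 := by
        rcases h' : s.split? f with _ | ⟨c, s'⟩
        · simp [form_comm_of_none h']
        · rw [eq_cons_of_split? h', form_cons_cons, form_cons_cons, form_lmul_right,
            G.transfer_mul_E, mul_one, mul_one]
      rcases h' : t'.split? e with _ | ⟨c, t''⟩
      · have h8 : (t'.lmul (G.transfer f b)).split? e = none := by rw [split?_lmul, h']; rfl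
        rw [preEdgeOp_none he h2 h8, ip_ofWord, h7]
      · have h0 : G.E e c = 0 := by
          subst he; exact ht.1 c t'' h'
        obtain rfl := eq_cons_of_split? h'
        obtain ⟨h8, h9, h10⟩ := preEdgeOp_cons (a := G.transfer f b * c) he h2
        have h11 : G.E e (G.transfer f b * c) = 0 := by
          subst he; rw [G.E_reverse_transfer_mul, h0, mul_zero]
        rw [show ofWord ((cons e c t'').lmul (G.transfer f b)) h2
          = ofWord (cons e (G.transfer f b * c) t'') h2 from rfl, h10, ip_add_right, ip_ofWord,
          ip_ofWord, ← G.transfer_E e, h11, map_zero, form_lmul_zero, sub_zero, add_zero]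
        exact h7
    rw [key, h6, ip_add_right, ip_ofWord, ip_ofWord, G.E_one, sub_self, form_zero_letter',
      G.transfer_one, form_lmul_right, mul_one, zero_add, form_cons_sub, ip_ofWord]
    abel

lemma ip_preEdgeOp_preEdgeOp {e : q ⟶ x} {f : x ⟶ q} (hf : f = reverse e) (he : e = reverse f)
    (a b : G.PathSpace x p) : ip 1 a (preEdgeOp f (preEdgeOp e b)) = ip 1 a b :=
  ip_ext ((isSesq_ip 1).comp .id (preEdgeOp f ∘ₗ preEdgeOp e) .id) (isSesq_ip 1)
    (fun t ht s hs => by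
      simp only [LinearMap.id_coe, id_eq]
      exact ip_preEdgeOp_preEdgeOp_ofWord hf he hs ht) a b

lemma norm_preEdgeOp_le (e : q ⟶ x) (a : G.PathSpace x p) : ‖preEdgeOp e a‖ ≤ 1 * ‖a‖ := by
  refine PreHilbertModule.norm_le_of_inner_le (A := G.A p) (by positivity) ?_
  rw [one_mul, PreHilbertModule.norm_sq_eq (A := G.A p) a, inner_def, inner_def,
    ip_preEdgeOp rfl (Quiver.reverse_reverse e).symm,
    ip_preEdgeOp_preEdgeOp rfl (Quiver.reverse_reverse e).symm]

/-- The unitary `u_e : 𝓗_{r(e),p} → 𝓗_{s(e),p}`. -/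
noncomputable def edgeOp (p : V) (e : q ⟶ x) : G.PathModule x p →L[ℂ] G.PathModule q p :=
  ((preEdgeOp e).mkContinuous 1 (norm_preEdgeOp_le e)).completion

lemma isAdjointOp_edgeOp (e : q ⟶ x) :
    IsAdjointOp (G.A p) (edgeOp p e) (edgeOp p (reverse e)) :=
  completion_isAdjointOp _ _ fun a b => by
    rw [LinearMap.mkContinuous_apply, LinearMap.mkContinuous_apply,
      ip_preEdgeOp rfl (Quiver.reverse_reverse e).symm]

lemma edgeOp_reverse_comp (e : q ⟶ x) :
    edgeOp (G := G) p (reverse e) ∘L edgeOp p e = ContinuousLinearMap.id ℂ _ := by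
  ext a
  refine PreHilbertModule.ext_inner (A := G.A p) fun b => ?_
  refine Completion.induction_on₂ a b (isClosed_eq ?_ ?_) fun a b => ?_
  · exact PreHilbertModule.completion_continuous_inner.comp
      (continuous_snd.prodMk ((ContinuousLinearMap.continuous _).comp continuous_fst))
  · exact PreHilbertModule.completion_continuous_inner.comp
      (continuous_snd.prodMk ((ContinuousLinearMap.continuous _).comp continuous_fst))
  · rw [ContinuousLinearMap.comp_apply, edgeOp, edgeOp, ContinuousLinearMap.completion_apply_coe,
      ContinuousLinearMap.completion_apply_coe, PreHilbertModule.completion_inner_coe,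
      ContinuousLinearMap.id_apply, PreHilbertModule.completion_inner_coe]
    exact ip_preEdgeOp_preEdgeOp rfl (Quiver.reverse_reverse e).symm b a

/-- The operator `u_w = u_{e₁} ⋯ u_{eₙ}` of a path `w = (e₁, …, eₙ)`. -/
noncomputable def pathOp (p : V) {q : V} :
    ∀ {x : V}, Quiver.Path q x → (G.PathModule x p →L[ℂ] G.PathModule q p)
  | _, .nil => ContinuousLinearMap.id ℂ _
  | _, .cons w e => pathOp p w ∘L edgeOp p e

/-- The operator `a₀ u_{e₁} a₁ ⋯ u_{eₙ} aₙ` of a word `a₀ e₁ a₁ ⋯ eₙ aₙ`. -/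
noncomputable def wordOp (p : V) :
    ∀ {q x : V}, Word G q x → (G.PathModule x p →L[ℂ] G.PathModule q p)
  | _, _, .nil a => leftAct p a
  | _, _, .cons e a t => leftAct p a ∘L edgeOp p e ∘L wordOp p t

end Operators

end GraphWithExpectations

/-! ### The reduced fundamental C⋆-algebra -/

namespace GraphWithExpectations

open Word

section Fundamental

variable {V : Type u} [Quiver.{v} V] [Quiver.HasInvolutiveReverse V]
  (G : GraphWithExpectations.{u, v, w, w'} V)

/-- The operators `u_z^* a u_w` on `𝓗_{p₀,p}`, for paths `z`, `w` from a vertex `q` to `p₀` and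
`a ∈ A_q`. -/
def fundamentalGenerators (p₀ p : V) : Set (adjointable (G.A p) (G.PathModule p₀ p)) :=
  {T | ∃ (q : V) (z w : Quiver.Path q p₀) (a : G.A q)
    (S : G.PathModule q p →L[ℂ] G.PathModule p₀ p),
    IsAdjointOp (G.A p) (pathOp p z) S ∧ T.1 = S ∘L leftAct p a ∘L pathOp p w}

/-- The reduced fundamental C⋆-algebra `P_p(p₀)` rooted in `p₀` with base `p`: the C⋆-subalgebra of
`𝓛(𝓗_{p₀,p})` generated by the operators `u_z^* a u_w`. -/
noncomputable def fundamentalAlgebra (p₀ p : V) :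
    StarSubalgebra ℂ (adjointable (G.A p) (G.PathModule p₀ p)) :=
  (StarAlgebra.adjoin ℂ (G.fundamentalGenerators p₀ p)).topologicalClosure

variable {G} {q x p p₀ : V}

lemma exists_isAdjointOp_wordOp (t : Word G q x) :
    ∃ S, IsAdjointOp (G.A p) (wordOp p t) S := by
  induction t with
  | nil a => exact ⟨_, isAdjointOp_leftAct a⟩
  | cons e a t ih =>
    obtain ⟨S, hS⟩ := ih
    exact ⟨_, (hS.comp (isAdjointOp_edgeOp e)).comp (isAdjointOp_leftAct a)⟩

lemma pathOp_comp {y : V} (g : Quiver.Path q x) (g' : Quiver.Path x y) :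
    pathOp (G := G) p (g.comp g') = pathOp p g ∘L pathOp p g' := by
  induction g' with
  | nil => rfl
  | cons g' e ih =>
    rw [Quiver.Path.comp_cons, pathOp, ih, pathOp, ContinuousLinearMap.comp_assoc]

lemma edgeOp_comp_reverse (e : q ⟶ x) :
    edgeOp (G := G) p e ∘L edgeOp p (reverse e) = ContinuousLinearMap.id ℂ _ := by
  have := edgeOp_reverse_comp (G := G) (p := p) (reverse e)
  rwa [Quiver.reverse_reverse] at this

lemma exists_isAdjointOp_pathOp (g : Quiver.Path q x) :
    ∃ g' : Quiver.Path x q, IsAdjointOp (G.A p) (pathOp (G := G) p g) (pathOp p g') ∧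
      pathOp (G := G) p g' ∘L pathOp p g = ContinuousLinearMap.id ℂ _ := by
  induction g with
  | nil => exact ⟨.nil, fun _ _ => rfl, rfl⟩
  | cons g e ih =>
    obtain ⟨g', h1, h2⟩ := ih
    have h3 : ∀ {y z : V} (f : y ⟶ z), pathOp (G := G) p f.toPath = edgeOp p f := fun f => rfl
    refine ⟨(reverse e).toPath.comp g', ?_, ?_⟩
    · rw [pathOp_comp, h3]
      exact (isAdjointOp_edgeOp e).comp h1
    · rw [pathOp_comp, h3, pathOp, ContinuousLinearMap.comp_assoc,
        ← ContinuousLinearMap.comp_assoc (pathOp p g'), h2, ContinuousLinearMap.id_comp,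
        edgeOp_reverse_comp]

lemma generator_mem (g : Quiver.Path p₀ q) (a : G.A q) (g' : Quiver.Path q p₀) :
    ∃ h, (⟨pathOp p g ∘L leftAct p a ∘L pathOp p g', h⟩ :
      adjointable (G.A p) (G.PathModule p₀ p)) ∈ G.fundamentalAlgebra p₀ p := by
  obtain ⟨z, hz, -⟩ := exists_isAdjointOp_pathOp (G := G) (p := p) g
  obtain ⟨z', hz', -⟩ := exists_isAdjointOp_pathOp (G := G) (p := p) g'
  exact ⟨⟨_, (hz'.comp (isAdjointOp_leftAct a)).comp hz⟩,
    StarSubalgebra.le_topologicalClosure _ (StarAlgebra.subset_adjoin ℂ _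
      ⟨q, z, g', a, _, hz.symm, rfl⟩)⟩

lemma pathOp_wordOp_mem (t : Word G q p₀) (g : Quiver.Path p₀ q) :
    ∃ h, (⟨pathOp p g ∘L wordOp p t, h⟩ : adjointable (G.A p) (G.PathModule p₀ p)) ∈
      G.fundamentalAlgebra p₀ p := by
  induction t with
  | nil a => exact generator_mem g a .nil
  | @cons q' y r e a t ih =>
    obtain ⟨h1, h2⟩ := ih (g.cons e)
    obtain ⟨g', h3, h4⟩ := exists_isAdjointOp_pathOp (G := G) (p := p) g
    obtain ⟨h5, h6⟩ := generator_mem (p := p) g a g'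
    have h7 := mul_mem h6 h2
    have h8 : (pathOp p g ∘L leftAct p a ∘L pathOp p g') ∘L (pathOp p (g.cons e) ∘L wordOp p t)
        = pathOp p g ∘L wordOp p (.cons e a t) := by
      rw [pathOp, wordOp]
      simp only [ContinuousLinearMap.comp_assoc]
      rw [← ContinuousLinearMap.comp_assoc (pathOp p g'), h4, ContinuousLinearMap.id_comp]
    have h9 : pathOp p g ∘L wordOp p (.cons e a t) ∈ adjointable (G.A p) (G.PathModule r p) := by
      rw [← h8]; exact mul_mem h5 h1
    refine ⟨h9, ?_⟩
    have h10 : (⟨_, h9⟩ : adjointable (G.A p) (G.PathModule r p)) = ⟨_, h5⟩ * ⟨_, h1⟩ :=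
      Subtype.ext h8.symm
    rw [h10]
    exact h7

/-- The operator `a₀ u_{e₁} a₁ ⋯ u_{eₙ} aₙ` on `𝓗_{p₀,p}`, for a closed path `(e₁, …, eₙ)` at `p₀`,
as an element of `P_p(p₀)`. -/
noncomputable def fundamentalOp (p : V) (t : Word G p₀ p₀) : G.fundamentalAlgebra p₀ p :=
  ⟨⟨wordOp p t, exists_isAdjointOp_wordOp t⟩, (pathOp_wordOp_mem t .nil).choose_spec⟩

end Fundamental

end GraphWithExpectations

/-! ### Graphs of C⋆-algebras with states -/

/-- A path without backtracking: two consecutive edges are never reverse to each other. -/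
def NonBacktracking {V : Type u} [Quiver.{v} V] [Quiver.HasInvolutiveReverse V] {p q : V}
    (g : Quiver.Path p q) : Prop :=
  ¬ ∃ (x y : V) (g₁ : Quiver.Path p x) (e : x ⟶ y) (g₂ : Quiver.Path x q),
    g = ((g₁.cons e).cons (reverse e)).comp g₂

/-- A graph of C⋆-algebras with states: there are conditional expectations and states `φ q` of
`A_q`, `φE e` of `B_e` such that `φE ē = φE e` and `φ (s(e)) = φE e ∘ s_e⁻¹ ∘ E_e`. -/
structure GraphWithStates (V : Type u) [Quiver.{v} V] [Quiver.HasInvolutiveReverse V]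
    extends GraphWithExpectations.{u, v, w, w'} V where
  φ : ∀ q : V, A q →ₗ[ℂ] ℂ
  isState : ∀ q, IsState (φ q)
  φE : ∀ {p q : V} (e : p ⟶ q), B e →ₗ[ℂ] ℂ
  isState_edge : ∀ {p q : V} (e : p ⟶ q), IsState (φE e)
  φE_bar : ∀ {p q : V} (e : p ⟶ q) (b : B e), φE (reverse e) (bar e b) = φE e b
  φ_eq : ∀ {p q : V} (e : p ⟶ q) (a : A p), φ p a = φE e (toGraphWithExpectations.sInvE e a)

namespace GraphWithStates

open GraphWithExpectations

variable {V : Type u} [Quiver.{v} V] [Quiver.HasInvolutiveReverse V]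
  (G : GraphWithStates.{u, v, w, w'} V)

/-- The reduced fundamental C⋆-algebra `P_p(p₀)`. -/
noncomputable abbrev P (p₀ p : V) :
    StarSubalgebra ℂ (adjointable (G.A p) (G.PathModule p₀ p)) :=
  G.fundamentalAlgebra p₀ p

/-- `φ` is a fundamental state of `P_p(p₀)`: a state which restricts to `φ_{p₀}` on `A_{p₀}` and
vanishes on the reduced operators with at least one edge. -/
structure IsFundamentalState (p₀ p : V) (φ : G.P p₀ p →ₗ[ℂ] ℂ) : Prop where
  isState : IsState φ
  apply_vertex : ∀ a : G.A p₀, φ (fundamentalOp p (.nil a)) = G.φ p₀ a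
  apply_reduced : ∀ t : Word G.toGraphWithExpectations p₀ p₀, t.Reduced → 1 ≤ t.length →
    φ (fundamentalOp p t) = 0

/-- The Hilbert space `H_{p₀,φ_p}` of the GNS construction of `(𝓗_{p₀,p}, φ_p)`. -/
abbrev H (p₀ p : V) : Type max u v w := GNSSpace (G.PathModule p₀ p) (G.isState p)

/-- The representation `π_{p₀,φ_p}` of `P_p(p₀)` on `H_{p₀,φ_p}`. -/
noncomputable def π (p₀ p : V) : G.P p₀ p →⋆ₐ[ℂ] (G.H p₀ p →L[ℂ] G.H p₀ p) :=
  (gnsRep (G.isState p)).comp (G.P p₀ p).subtype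

/-- The vector `Ω = u_g (1_{A_p})` of `𝓗_{p₀,p}`, for a path `g` from `p₀` to `p`. -/
noncomputable def Ω {p₀ p : V} (g : Quiver.Path p₀ p) : G.PathModule p₀ p :=
  pathOp p g ((ofWord (.nil 1) trivial : G.PathSpace p p) : G.PathModule p p)

/-- The vector `ξ` of `H_{p₀,φ_p}` given by `Ω`. -/
noncomputable def ξ {p₀ p : V} (g : Quiver.Path p₀ p) : G.H p₀ p :=
  gnsVector _ (G.isState p) (G.Ω g)

end GraphWithStates

/-!
The operators `a₀ u_{e₁} a₁ ⋯ u_{eₙ} aₙ` satisfy the same linear relations for every base `p`.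
Indeed, the relation `u_e E_ē(b) u_ē = (r_ē ∘ s_ē⁻¹ ∘ E_ē)(b)`
(`edgeOp_comp_leftAct_E_comp_edgeOp`) allows one to split a letter at a backtracking into its part
in the kernel of the expectation and a part which shortens the word, so that every such operator is
a linear combination of reduced ones, with words and coefficients independent of `p`
(`wordOp_mem_reducedSpan`). Products and adjoints of word operators are word operators, so the
reduced operators span a dense subspace of `P_p(p₀)` (`mem_of_isClosed_of_reduced`). This gives all
the uniqueness statements, because states and isomorphisms are continuous.

The heart of the proof is that, for every path `g` from `p₀` to `r`, the functional
`T ↦ φ_r ⟨u_g 1, T u_g 1⟩` restricts to `φ_{p₀}` on `A_{p₀}` and vanishes on the reduced operators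
with at least one edge (`isFundamentalOn_pathFunctional`).
* For the trivial path this holds because a reduced operator maps the vacuum vector `1` to the
  elementary tensor with the same letters.
* For a single edge `e`, one reduces `u_e^* t` on the left and is left with inner products
  `⟨1, s u_e 1⟩ = ⟨s^* 1, u_e 1⟩` for reduced words `s`. They vanish unless `s` has exactly one
  edge, and then `t = a e b ē c` with `E_ē(b) = 0`; this last contribution is killed by `φ`, which
  factors through `E_ē`.
* For `g e`, the operator `u_g^* t u_g` is again a word operator, on which the functionals of `e`
  and of the trivial path agree by the independence of the relations from the base. Thus the
  functional of `g e` has the same values as that of `g`.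

No condition on backtracking of `g` is needed, since `u_e u_ē = 1`.

The vectors `π(t) ξ`, for `t` a closed word at `p₀`, are total, and their Gram matrix consists of
values of the fundamental state on words `t^* s`; hence it does not depend on the base and the GNS
representations are unitarily equivalent (`exists_unitary`). If the states are faithful, the GNS
representations are faithful, and comparing their ranges gives the isomorphism of the algebras
(`exists_starAlgEquiv_of_injective`).
-/

/-! ### Operations on words -/

namespace Word

variable {V : Type u} [Quiver.{v} V] [Quiver.HasInvolutiveReverse V]
  {G : GraphWithExpectations.{u, v, w, w'} V}

@[simp] lemma length_nil {p : V} (a : G.A p) : (nil a : Word G p p).length = 0 := rfl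

@[simp] lemma length_cons {q x p : V} (e : q ⟶ x) (a : G.A q) (t : Word G x p) :
    (cons e a t).length = t.length + 1 := rfl

@[simp] lemma length_lmul {q p : V} (a : G.A q) (t : Word G q p) :
    (t.lmul a).length = t.length := by
  cases t <;> rfl

@[simp] lemma lmul_nil {p : V} (a b : G.A p) :
    (nil b : Word G p p).lmul a = nil (a * b) := rfl

@[simp] lemma lmul_cons {q x p : V} (e : q ⟶ x) (a b : G.A q) (t : Word G x p) :
    (cons e b t).lmul a = cons e (a * b) t := rfl

lemma lmul_lmul {q p : V} (a b : G.A q) (t : Word G q p) :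
    (t.lmul b).lmul a = t.lmul (a * b) := by
  cases t <;> simp [mul_assoc]

lemma lmul_one {q p : V} (t : Word G q p) : t.lmul 1 = t := by
  cases t <;> simp

/-- The product of two words: the last letter of `t` is multiplied with the first letter of `s`. -/
def append : ∀ {q x p : V}, Word G q x → Word G x p → Word G q p
  | _, _, _, nil a, s => s.lmul a
  | _, _, _, cons e a t, s => cons e a (t.append s)

/-- The product `t^* s`, where the adjoint of `a₀ e₁ a₁ ⋯ eₙ aₙ` is `aₙ^* ēₙ ⋯ a₁^* ē₁ a₀^*`. -/
def revAppend : ∀ {q x p : V}, Word G q x → Word G q p → Word G x p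
  | _, _, _, nil a, s => s.lmul (star a)
  | _, _, _, cons e a t, s => t.revAppend (cons (reverse e) 1 (s.lmul (star a)))

/-- The word `1 e₁ 1 ⋯ eₙ 1` over a path. -/
def ofPath (G : GraphWithExpectations.{u, v, w, w'} V) {q : V} :
    ∀ {x : V}, Quiver.Path q x → Word G q x
  | _, .nil => nil 1
  | _, .cons g e => (ofPath G g).append (cons e 1 (nil 1))

lemma length_revAppend {q x p : V} (t : Word G q x) (s : Word G q p) :
    (t.revAppend s).length = t.length + s.length := by
  induction t with
  | nil a => simp [revAppend]
  | cons e a t ih => rw [revAppend, ih]; simp; omega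

lemma ReducedAfter.nil {q x : V} (e : q ⟶ x) (a : G.A x) : (nil a : Word G x x).ReducedAfter e :=
  fun _ _ h => by simp at h

lemma ReducedAfter.of_split?_eq_none {q x p : V} {e : q ⟶ x} {t : Word G x p}
    (h : t.split? (reverse e) = none) : t.ReducedAfter e := by
  intro b s hs
  simp [h] at hs

/-- The product `t^* s` of reduced words is reduced as soon as there is no backtracking at the
junction of `t^*` and `s`. -/
lemma Reduced.revAppend {q x p : V} {t : Word G q x} {s : Word G q p} (ht : t.Reduced)
    (hs : s.Reduced)
    (hts : ∀ (y : V) (e : q ⟶ y) (a : G.A q) (t' : Word G y x), t = cons e a t' →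
      (s.lmul (star a)).ReducedAfter (reverse e)) :
    (t.revAppend s).Reduced := by
  induction t with
  | nil a => exact hs.lmul _
  | cons e a t ih =>
    refine ih ht.2 ⟨hts _ _ _ _ rfl, hs.lmul _⟩ fun y f b t' ht' => ?_
    subst ht'
    intro c s' hc
    rw [lmul_cons] at hc
    -- at a junction `f̄ b^* ē` there is a backtracking only if `f = ē`, and then `E_f(b) = 0`
    have hne : (⟨_, reverse e⟩ : Σ z, _ ⟶ z) = ⟨_, reverse (reverse f)⟩ := by
      by_contra hne
      rw [split?_cons_of_ne hne] at hc
      cases hc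
    obtain ⟨hx, hf⟩ := Sigma.mk.inj_iff.1 hne
    subst hx
    rw [← eq_of_heq hf] at hc ⊢
    have hfe : f = reverse e := by rw [eq_of_heq hf, Quiver.reverse_reverse]
    rw [split?_cons_self] at hc
    cases hc
    have h0 : G.E (reverse e) b = 0 := ht.1 b t' (by rw [hfe, split?_cons_self])
    rw [mul_one, G.E_star, h0, star_zero]

lemma Reduced.revAppend_nil {q x : V} {t : Word G q x} (ht : t.Reduced) (a : G.A q) :
    (t.revAppend (nil a)).Reduced :=
  ht.revAppend trivial fun _ e b _ _ => .nil (reverse e) (star b * a)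

/-- The inner product of the path modules is balanced over the edge algebras. -/
lemma form_cons_lmul_E {q x p : V} {e : q ⟶ x} {f : x ⟶ q} (he : e = reverse f)
    (s : Word G q p) (a : G.A q) (b : G.A x) (t : Word G x p) (z : G.A q) :
    s.form (cons e a (t.lmul (G.E f b))) z = s.form (cons e (a * G.transfer f b) t) z := by
  rcases h : s.split? e with _ | ⟨c, s'⟩
  · rw [form_comm_of_none h, form_comm_of_none h]
  · subst he
    rw [eq_cons_of_split? h, form_cons_cons, form_cons_cons, form_lmul_right,
      ← G.E_reverse_transfer f b, ← mul_assoc, G.transfer_mul_E, G.transfer_reverse_transfer]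

end Word

/-! ### Relations between the operators -/

namespace GraphWithExpectations

open Word

variable {V : Type u} [Quiver.{v} V] [Quiver.HasInvolutiveReverse V]
  {G : GraphWithExpectations.{u, v, w, w'} V} {q x y p : V}

/-- Vectors of the path module are determined by their inner products with elementary tensors. -/
lemma ext_ip {a b : G.PathSpace q p}
    (h : ∀ (s : Word G q p) (hs : s.Reduced), ip 1 (ofWord s hs) a = ip 1 (ofWord s hs) b) :
    (a : G.PathModule q p) = b := by
  refine PreHilbertModule.ext_inner (A := G.A p) fun z => ?_
  refine Completion.induction_on z (isClosed_eq ?_ ?_) fun z => ?_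
  · exact PreHilbertModule.completion_continuous_inner.comp (continuous_id.prodMk continuous_const)
  · exact PreHilbertModule.completion_continuous_inner.comp (continuous_id.prodMk continuous_const)
  rw [PreHilbertModule.completion_inner_coe, PreHilbertModule.completion_inner_coe, inner_def,
    inner_def]
  induction z using pathSpace_induction with
  | h0 => rw [ip_zero_left, ip_zero_left]
  | ha u v hu hv => rw [ip_add_left, ip_add_left, hu, hv]
  | hw c t ht => rw [ip_smul_left, ip_smul_left, h]

/-- Bounded operators which agree on the elementary tensors are equal. -/
lemma ext_ofWord {F : Type*} [NormedAddCommGroup F] [NormedSpace ℂ F]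
    {T S : G.PathModule q p →L[ℂ] F}
    (h : ∀ (t : Word G q p) (ht : t.Reduced), T (ofWord t ht : G.PathSpace q p) =
      S (ofWord t ht : G.PathSpace q p)) : T = S := by
  ext z
  refine Completion.induction_on z (isClosed_eq T.continuous S.continuous) fun z => ?_
  induction z using pathSpace_induction with
  | h0 => rw [Completion.coe_zero, map_zero, map_zero]
  | ha u v hu hv => rw [Completion.coe_add, map_add, map_add, hu, hv]
  | hw c t ht => rw [Completion.coe_smul, map_smul, map_smul, h]

lemma leftAct_coe (a : G.A q) (z : G.PathSpace q p) :
    leftAct p a (z : G.PathModule q p) = (preLeftAct a z : G.PathSpace q p) :=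
  ContinuousLinearMap.completion_apply_coe _ _

lemma edgeOp_coe (e : q ⟶ x) (z : G.PathSpace x p) :
    edgeOp p e (z : G.PathModule x p) = (preEdgeOp e z : G.PathSpace q p) :=
  ContinuousLinearMap.completion_apply_coe _ _

lemma leftAct_ofWord (a : G.A q) {t : Word G q p} (ht : t.Reduced) :
    leftAct p a (ofWord t ht : G.PathSpace q p) = (ofWord (t.lmul a) (ht.lmul a)) := by
  rw [leftAct_coe, preLeftAct, liftWord_ofWord]

lemma leftAct_add (a b : G.A q) : leftAct p (a + b) = leftAct p a + leftAct p b := by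
  refine ext_ofWord fun t ht => ?_
  rw [add_apply, leftAct_ofWord, leftAct_ofWord, leftAct_ofWord, ← Completion.coe_add]
  refine ext_ip fun s hs => ?_
  simp only [ip_add_right, ip_ofWord, form_lmul_right, mul_add, form_add]

lemma leftAct_mul (a b : G.A q) : leftAct p (a * b) = leftAct p a ∘L leftAct p b := by
  refine ext_ofWord fun t ht => ?_
  rw [ContinuousLinearMap.comp_apply, leftAct_ofWord, leftAct_ofWord, leftAct_ofWord]
  simp only [lmul_lmul]

lemma leftAct_one : leftAct p (1 : G.A q) = ContinuousLinearMap.id ℂ _ := by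
  refine ext_ofWord fun t ht => ?_
  rw [leftAct_ofWord]
  simp only [lmul_one, ContinuousLinearMap.id_apply]

/-- The unitary `u_e` intertwines the two actions of the edge algebra, up to the expectation. -/
lemma edgeOp_comp_leftAct_E {e : q ⟶ x} {f : x ⟶ q} (hf : f = reverse e) (he : e = reverse f)
    (b : G.A x) :
    edgeOp p e ∘L leftAct p (G.E f b) = leftAct p (G.transfer f b) ∘L edgeOp p e := by
  refine ext_ofWord fun t ht => ?_
  rw [ContinuousLinearMap.comp_apply, ContinuousLinearMap.comp_apply, leftAct_ofWord, edgeOp_coe,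
    edgeOp_coe, leftAct_coe]
  refine ext_ip fun s hs => ?_
  rw [ip_preLeftAct_right]
  rcases h : t.split? f with _ | ⟨a, t'⟩
  · rw [preEdgeOp_none hf ht h, preEdgeOp_none hf (ht.lmul _) (by rw [split?_lmul, h]; rfl),
      ip_ofWord, ip_ofWord, form_cons_lmul_E he, ← form_lmul_right, lmul_cons, one_mul, mul_one]
  · obtain rfl := eq_cons_of_split? h
    obtain ⟨h1, h2, h3⟩ := preEdgeOp_cons hf ht
    obtain ⟨h4, h5, h6⟩ := preEdgeOp_cons (a := G.E f b * a) hf (ht.lmul (G.E f b))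
    have hE : G.E f (G.E f b * a) = G.E f b * G.E f a := by
      obtain ⟨c, hc⟩ := G.E_mem f b
      rw [← hc, G.E_left]
    have hw : cons e 1 (cons f (G.E f b * a - G.E f (G.E f b * a)) t')
        = cons e 1 ((cons f (a - G.E f a) t').lmul (G.E f b)) := by
      rw [hE, ← mul_sub, lmul_cons]
    change ip 1 _ (preEdgeOp e (ofWord (cons f (G.E f b * a) t') _)) = _
    rw [h6, h3, ip_add_right, ip_add_right, ip_ofWord, ip_ofWord, ip_ofWord, ip_ofWord, hw,
      form_cons_lmul_E he, ← form_lmul_right, lmul_cons, G.transfer_E_mul, ← form_lmul_right,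
      lmul_lmul, one_mul, mul_one]

/-- The part of a letter in the range of the expectation is absorbed by a backtracking. -/
lemma edgeOp_comp_leftAct_E_comp_edgeOp {e : q ⟶ x} {f : x ⟶ q} (hf : f = reverse e)
    (he : e = reverse f) (b : G.A x) :
    edgeOp p e ∘L leftAct p (G.E f b) ∘L edgeOp p f = leftAct p (G.transfer f b) := by
  rw [← ContinuousLinearMap.comp_assoc, edgeOp_comp_leftAct_E hf he, ContinuousLinearMap.comp_assoc,
    hf, edgeOp_comp_reverse, ContinuousLinearMap.comp_id]

lemma wordOp_nil (a : G.A p) : wordOp x (nil a : Word G p p) = leftAct x a := rfl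

lemma wordOp_cons (e : q ⟶ x) (a : G.A q) (t : Word G x y) :
    wordOp p (cons e a t) = leftAct p a ∘L edgeOp p e ∘L wordOp p t := rfl

lemma wordOp_lmul (a : G.A q) (t : Word G q x) :
    wordOp p (t.lmul a) = leftAct p a ∘L wordOp p t := by
  cases t <;> simp only [lmul, wordOp, leftAct_mul, ContinuousLinearMap.comp_assoc]

lemma wordOp_append (t : Word G q x) (s : Word G x y) :
    wordOp p (t.append s) = wordOp p t ∘L wordOp p s := by
  induction t with
  | nil a => exact wordOp_lmul a s
  | cons e a t ih => simp only [append, wordOp, ih, ContinuousLinearMap.comp_assoc]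

lemma wordOp_ofPath (g : Quiver.Path q x) : wordOp p (ofPath G g) = pathOp p g := by
  induction g with
  | nil => exact leftAct_one
  | cons g e ih =>
    rw [ofPath, wordOp_append, ih, wordOp, wordOp, leftAct_one, leftAct_one,
      ContinuousLinearMap.id_comp, ContinuousLinearMap.comp_id, pathOp]

/-- The operator of `t^* s` is the adjoint of that of `t`, composed with that of `s`. -/
lemma inner_wordOp_left (t : Word G q x) (s : Word G q y) (a : G.PathModule x p)
    (b : G.PathModule y p) :
    inner (G.A p) (wordOp p t a) (wordOp p s b) =
      inner (G.A p) a (wordOp p (t.revAppend s) b) := by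
  induction t with
  | nil c =>
    rw [revAppend, wordOp_lmul, wordOp, isAdjointOp_leftAct c]
    rfl
  | cons e c t ih =>
    rw [revAppend, ← ih, wordOp, wordOp, wordOp_lmul, leftAct_one]
    exact ((isAdjointOp_edgeOp e).comp (isAdjointOp_leftAct c)) _ _

lemma isAdjointOp_wordOp (t : Word G q x) :
    IsAdjointOp (G.A p) (wordOp p t) (wordOp p (t.revAppend (nil 1))) := fun a b => by
  rw [← inner_wordOp_left, wordOp_nil, leftAct_one, ContinuousLinearMap.id_apply]

/-- The vacuum vector `1_{A_p}` of `𝓗_{p,p}`. -/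
noncomputable def vacuum (G : GraphWithExpectations.{u, v, w, w'} V) (p : V) : G.PathModule p p :=
  ((ofWord (.nil 1) trivial : G.PathSpace p p) : G.PathModule p p)

/-- A reduced operator maps the vacuum vector to the elementary tensor with the same letters. -/
lemma wordOp_vacuum {t : Word G q p} (ht : t.Reduced) :
    wordOp p t (G.vacuum p) = (ofWord t ht : G.PathSpace q p) := by
  induction t with
  | nil a =>
    refine (leftAct_ofWord a (t := nil 1) trivial).trans ?_
    simp only [lmul_nil, mul_one]
  | @cons q x p e a t ih =>
    rw [wordOp, ContinuousLinearMap.comp_apply, ContinuousLinearMap.comp_apply, ih ht.2, edgeOp_coe,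
      leftAct_coe]
    refine ext_ip fun s hs => ?_
    rw [ip_preLeftAct_right, one_mul]
    rcases h : t.split? (reverse e) with _ | ⟨b, t'⟩
    · rw [preEdgeOp_none rfl ht.2 h, ip_ofWord, ip_ofWord, ← one_mul a, ← form_lmul_right,
        lmul_cons, mul_one, one_mul]
    · have h0 := ht.1 b t' h
      obtain rfl := eq_cons_of_split? h
      obtain ⟨h1, h2, h3⟩ := preEdgeOp_cons rfl ht.2
      rw [h3, ip_add_right, ip_ofWord, ip_ofWord, ip_ofWord, ← G.transfer_E, h0, map_zero,
        form_lmul_zero, add_zero, ← one_mul a, ← form_lmul_right, lmul_cons, sub_zero, mul_one,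
        one_mul]

end GraphWithExpectations

/-! ### Reduction of words -/

namespace GraphWithExpectations

open Word

variable {V : Type u} [Quiver.{v} V] [Quiver.HasInvolutiveReverse V]
  {G : GraphWithExpectations.{u, v, w, w'} V} {q x y p : V}

/-- One reduction step at a backtracking `e ē`. -/
lemma wordOp_cons_cons {e : q ⟶ x} {f : x ⟶ q} (hf : f = reverse e) (he : e = reverse f)
    (a : G.A q) (b : G.A x) (t : Word G q y) :
    wordOp p (cons e a (cons f b t)) = wordOp p (cons e a (cons f (b - G.E f b) t)) +
      wordOp p (t.lmul (a * G.transfer f b)) := by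
  have hb : leftAct p b = leftAct p (b - G.E f b) + leftAct p (G.E f b) := by
    rw [← leftAct_add, sub_add_cancel]
  rw [wordOp_lmul, leftAct_mul, ← edgeOp_comp_leftAct_E_comp_edgeOp hf he]
  simp only [wordOp_cons]
  rw [hb]
  simp only [ContinuousLinearMap.add_comp, ContinuousLinearMap.comp_add,
    ContinuousLinearMap.comp_assoc]

/-- The span of the families of operators `(a₀ u^p_{e₁} a₁ ⋯ u^p_{eₙ} aₙ)_p`, indexed by the base
`p`, which are given by reduced words from `q` to `x`. Taking all bases at once expresses that
linear relations between operators of words do not depend on the base. -/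
noncomputable def reducedSpan (G : GraphWithExpectations.{u, v, w, w'} V) (q x : V) :
    Submodule ℂ (∀ p, G.PathModule x p →L[ℂ] G.PathModule q p) :=
  Submodule.span ℂ {F | ∃ t : Word G q x, t.Reduced ∧ F = fun p => wordOp p t}

lemma leftAct_comp_edgeOp_comp_mem_reducedSpan (a : G.A q) (e : q ⟶ x)
    {F : ∀ p, G.PathModule y p →L[ℂ] G.PathModule x p} (hF : F ∈ G.reducedSpan x y) :
    (fun p => leftAct p a ∘L edgeOp p e ∘L F p) ∈ G.reducedSpan q y := by
  induction hF using Submodule.span_induction with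
  | mem F hF =>
    obtain ⟨t, ht, rfl⟩ := hF
    simp only [← wordOp_cons]
    rcases h : t.split? (reverse e) with _ | ⟨b, t'⟩
    · exact Submodule.subset_span ⟨cons e a t, ⟨.of_split?_eq_none h, ht⟩, rfl⟩
    · obtain rfl := eq_cons_of_split? h
      rw [funext fun p => wordOp_cons_cons (p := p) rfl (Quiver.reverse_reverse e).symm a b t']
      exact add_mem (Submodule.subset_span ⟨cons e a (cons (reverse e) (b - G.E (reverse e) b) t'),
        ⟨ht.cons_one_cons.1, ht.cons_one_cons.2⟩, rfl⟩)
        (Submodule.subset_span ⟨_, ht.2.lmul _, rfl⟩)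
  | zero =>
    convert zero_mem (G.reducedSpan q y) using 1
    ext1 p
    rw [Pi.zero_apply, Pi.zero_apply, ContinuousLinearMap.comp_zero, ContinuousLinearMap.comp_zero]
  | add F F' _ _ h h' =>
    convert add_mem h h' using 1
    ext1 p
    simp only [Pi.add_apply, ContinuousLinearMap.comp_add]
  | smul c F _ h =>
    convert Submodule.smul_mem _ c h using 1
    ext1 p
    simp only [Pi.smul_apply, ContinuousLinearMap.comp_smul]

/-- The operator of every word is a linear combination of reduced operators, with the same words and
coefficients for all bases. -/
lemma wordOp_mem_reducedSpan (t : Word G q x) : (fun p => wordOp p t) ∈ G.reducedSpan q x := by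
  induction t with
  | nil a => exact Submodule.subset_span ⟨nil a, trivial, rfl⟩
  | cons e a t ih => exact leftAct_comp_edgeOp_comp_mem_reducedSpan a e ih

/-- Linear maps which agree on the reduced operators, for two bases, agree on the operators of all
words. -/
lemma eq_of_eq_on_reduced {M : Type*} [AddCommGroup M] [Module ℂ M] {p p' : V}
    (F : (G.PathModule x p →L[ℂ] G.PathModule q p) →ₗ[ℂ] M)
    (F' : (G.PathModule x p' →L[ℂ] G.PathModule q p') →ₗ[ℂ] M)
    (h : ∀ t : Word G q x, t.Reduced → F (wordOp p t) = F' (wordOp p' t)) (t : Word G q x) :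
    F (wordOp p t) = F' (wordOp p' t) := by
  have := wordOp_mem_reducedSpan t
  refine Submodule.span_induction (p := fun T _ => F (T p) = F' (T p')) ?_ ?_ ?_ ?_ this
  · rintro _ ⟨s, hs, rfl⟩
    exact h s hs
  · simp
  · intro T S _ _ h1 h2
    simp [h1, h2]
  · intro c T _ h1
    simp [h1]

lemma _root_.Word.form_of_length_ne {t s : Word G q p} (h : t.length ≠ s.length) (z : G.A q) :
    t.form s z = 0 := by
  induction t with
  | nil a => cases s with
    | nil b => exact absurd rfl h
    | cons => rw [form]
  | cons e a t ih =>
    rcases h' : s.split? e with _ | ⟨b, s'⟩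
    · exact form_cons_of_none h' z
    · obtain rfl := eq_cons_of_split? h'
      rw [form_cons_cons, ih fun h'' => h (congrArg (· + 1) h'')]

/-- The inner product of elementary tensors. -/
lemma inner_ofWord {t s : Word G q p} (ht : t.Reduced) (hs : s.Reduced) :
    inner (G.A p) ((ofWord t ht : G.PathSpace q p) : G.PathModule q p)
      ((ofWord s hs : G.PathSpace q p) : G.PathModule q p) = t.form s 1 := by
  rw [PreHilbertModule.completion_inner_coe, inner_def, ip_ofWord]

lemma inner_wordOp_vacuum {t s : Word G q p} (ht : t.Reduced) (hs : s.Reduced) :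
    inner (G.A p) (wordOp p t (G.vacuum p)) (wordOp p s (G.vacuum p)) = t.form s 1 := by
  rw [wordOp_vacuum ht, wordOp_vacuum hs, inner_ofWord]

lemma reduced_nil (a : G.A p) : (nil a : Word G p p).Reduced := trivial

lemma reduced_edge (e : q ⟶ x) : (cons e 1 (nil 1) : Word G q x).Reduced :=
  ⟨.nil _ _, trivial⟩

lemma edgeOp_vacuum (e : q ⟶ x) :
    edgeOp x e (G.vacuum x) = wordOp x (cons e 1 (nil 1)) (G.vacuum x) := by
  rw [wordOp_cons, wordOp_nil, leftAct_one, leftAct_one, ContinuousLinearMap.id_comp,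
    ContinuousLinearMap.comp_id]

/-- The matrix coefficient of a reduced operator `t` between the vacuum vector and `u_e` applied to
it is read off from the reduced word `t^*`. -/
lemma inner_vacuum_wordOp_edgeOp {t : Word G x q} (ht : t.Reduced) (e : q ⟶ x) :
    inner (G.A x) (G.vacuum x) (wordOp x t (edgeOp x e (G.vacuum x))) =
      (t.revAppend (nil 1)).form (cons e 1 (nil 1)) 1 := by
  rw [← (isAdjointOp_wordOp t).symm, edgeOp_vacuum,
    inner_wordOp_vacuum (ht.revAppend_nil 1) (reduced_edge e)]

lemma inner_vacuum_wordOp_edgeOp_of_length_ne {t : Word G x q} (ht : t.Reduced) (e : q ⟶ x)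
    (h : t.length ≠ 1) :
    inner (G.A x) (G.vacuum x) (wordOp x t (edgeOp x e (G.vacuum x))) = 0 := by
  rw [inner_vacuum_wordOp_edgeOp ht, form_of_length_ne]
  simpa [length_revAppend] using h

end GraphWithExpectations

/-! ### The functionals of the vectors `u_g 1` -/

namespace GraphWithStates

open GraphWithExpectations Word

variable {V : Type u} [Quiver.{v} V] [Quiver.HasInvolutiveReverse V]
  {G : GraphWithStates.{u, v, w, w'} V} {q x y p : V}

lemma φ_transfer (e : q ⟶ x) (a : G.A q) : G.φ x (G.transfer e a) = G.φ q a := by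
  have h : G.sInvE (reverse e) (G.transfer e a) = G.bar e (G.sInvE e a) := by
    apply G.s_injective (reverse e)
    rw [s_sInvE, E_reverse_transfer]; rfl
  rw [G.φ_eq (reverse e), h, G.φE_bar, ← G.φ_eq]

lemma φ_eq_zero_of_E {e : q ⟶ x} {a : G.A q} (h : G.E e a = 0) : G.φ q a = 0 := by
  have h' : G.sInvE e a = 0 := by
    rw [← sInvE_E, h, map_zero]
  rw [G.φ_eq e, h', map_zero]

/-- The functional `T ↦ φ_p ⟨u_g 1, T u_g 1⟩` of a path `g` from `q` to `p`. -/
noncomputable def pathFunctional (G : GraphWithStates.{u, v, w, w'} V) (g : Quiver.Path q p) :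
    (G.PathModule q p →L[ℂ] G.PathModule q p) →ₗ[ℂ] ℂ where
  toFun T := G.φ p (inner (G.A p) (G.Ω g) (T (G.Ω g)))
  map_add' T S := by rw [add_apply, PreHilbertModule.inner_add_right, map_add]
  map_smul' c T := by
    rw [smul_apply, PreHilbertModule.inner_smul_right, map_smul, RingHom.id_apply]

lemma pathFunctional_apply (g : Quiver.Path q p) (T : G.PathModule q p →L[ℂ] G.PathModule q p) :
    G.pathFunctional g T = G.φ p (inner (G.A p) (G.Ω g) (T (G.Ω g))) := rfl

lemma Ω_nil : G.Ω (.nil : Quiver.Path p p) = vacuum G.toGraphWithExpectations p := rfl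

lemma Ω_cons (g : Quiver.Path q x) (e : x ⟶ p) :
    G.Ω (g.cons e) = pathOp p g (edgeOp p e (vacuum G.toGraphWithExpectations p)) := rfl

lemma Ω_toPath (e : q ⟶ x) : G.Ω e.toPath = edgeOp x e (vacuum G.toGraphWithExpectations x) := rfl

lemma Ω_eq_wordOp (g : Quiver.Path q p) :
    G.Ω g = wordOp p (ofPath G.toGraphWithExpectations g)
      (vacuum G.toGraphWithExpectations p) := by
  rw [wordOp_ofPath]; rfl

/-- `F` takes the values of a fundamental state on the reduced operators: those of `φ_q` on `A_q`,
and `0` if there is at least one edge. -/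
structure IsFundamentalOn (F : (G.PathModule q p →L[ℂ] G.PathModule q p) →ₗ[ℂ] ℂ) : Prop where
  apply_nil : ∀ a : G.A q, F (wordOp p (nil a)) = G.φ q a
  apply_reduced : ∀ t : Word G.toGraphWithExpectations q q, t.Reduced → 1 ≤ t.length →
    F (wordOp p t) = 0

/-- The values of such functionals on the operators of all words do not depend on the base. -/
lemma IsFundamentalOn.eq {F : (G.PathModule q p →L[ℂ] G.PathModule q p) →ₗ[ℂ] ℂ}
    (hF : IsFundamentalOn F) {F' : (G.PathModule q x →L[ℂ] G.PathModule q x) →ₗ[ℂ] ℂ}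
    (hF' : IsFundamentalOn F') (t : Word G.toGraphWithExpectations q q) :
    F (wordOp p t) = F' (wordOp x t) := by
  refine eq_of_eq_on_reduced F F' (fun t ht => ?_) t
  rcases Nat.eq_zero_or_pos t.length with h | h
  · cases t with
    | nil a => rw [hF.apply_nil, hF'.apply_nil]
    | cons => simp at h
  · rw [hF.apply_reduced t ht h, hF'.apply_reduced t ht h]

lemma isFundamentalOn_nil : IsFundamentalOn (G.pathFunctional (.nil : Quiver.Path p p)) where
  apply_nil a := by
    rw [pathFunctional_apply, Ω_nil, wordOp_vacuum (reduced_nil a)]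
    refine congrArg _ ((inner_ofWord (reduced_nil 1) _).trans ?_)
    simp
  apply_reduced t ht h := by
    rw [pathFunctional_apply, Ω_nil, wordOp_vacuum ht]
    refine (congrArg _ ((inner_ofWord (reduced_nil 1) _).trans ?_)).trans (map_zero _)
    exact form_of_length_ne (by simpa using (Nat.pos_iff_ne_zero.1 h).symm) _

/-- Conjugation by `u_e` and reduction on the left leaves only words to which
`inner_vacuum_wordOp_edgeOp` applies; the single one which contributes to the inner product is
`a e b ē c` with `E_ē(b) = 0`, and its contribution is killed by the state. -/
lemma pathFunctional_toPath_reduced (e : q ⟶ x) {t : Word G.toGraphWithExpectations q q}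
    (ht : t.Reduced) (h : 1 ≤ t.length) : G.pathFunctional e.toPath (wordOp x t) = 0 := by
  have hE : inner (G.A x) (G.Ω e.toPath) (wordOp x t (G.Ω e.toPath)) =
      inner (G.A x) (vacuum G.toGraphWithExpectations x)
        (wordOp x (cons (reverse e) 1 t)
          (edgeOp x e (vacuum G.toGraphWithExpectations x))) := by
    rw [Ω_toPath, isAdjointOp_edgeOp, wordOp_cons, leftAct_one]
    rfl
  rw [pathFunctional_apply, hE]
  have hr := (Quiver.reverse_reverse e).symm
  rcases hs : t.split? e with _ | ⟨a, t'⟩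
  · rw [inner_vacuum_wordOp_edgeOp_of_length_ne (ht.cons_one (hr ▸ hs)) e, map_zero]
    simp only [length_cons]; omega
  · obtain rfl := eq_cons_of_split? hs
    -- `ē a e t'` reduces to `ē (a - E_e(a)) e t'`, of length at least two, and to `c t'` for
    -- `c = (r_e ∘ s_e⁻¹ ∘ E_e)(a)`, so that only `t'` of length one is left
    have ht1 : (cons (reverse e) 1 (cons e (a - G.E e a) t')).Reduced := by
      refine ⟨fun b s hb => ?_, ht⟩
      generalize hf : reverse (reverse e) = f at hb ⊢
      obtain rfl : f = e := by rw [← hf, ← hr]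
      rw [split?_cons_self] at hb
      cases hb
      rw [map_sub, G.E_E, sub_self]
    rw [wordOp_cons_cons hr rfl, add_apply, PreHilbertModule.inner_add_right,
      inner_vacuum_wordOp_edgeOp_of_length_ne ht1 e (by simp), zero_add, one_mul]
    by_cases h1 : (t'.lmul (G.transfer e a)).length = 1
    · cases t' with
      | nil c => simp at h1
      | cons f b t'' => cases t'' with
        | cons => simp at h1
        | nil c =>
          rw [inner_vacuum_wordOp_edgeOp (ht.2.lmul _), lmul_cons, revAppend, revAppend]
          simp only [lmul_nil, lmul_cons]
          rcases hs : (cons e 1 (nil 1) : Word G.toGraphWithExpectations q x).split? (reverse f)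
            with _ | ⟨c', s'⟩
          · rw [form_cons_of_none hs, map_zero]
          · have hef := eq_cons_of_split? hs
            simp only [Word.cons.injEq, heq_eq_eq, true_and] at hef
            obtain ⟨he, -, -⟩ := hef
            obtain rfl : f = reverse e := by rw [he, Quiver.reverse_reverse]
            -- now `t = a e b ē c`, and the inner product is in the kernel of `E_ē`
            have hb : G.E (reverse e) b = 0 := ht.1 b _ (split?_cons_self _ _ _)
            generalize reverse (reverse e) = e' at he
            subst he
            rw [form_cons_cons, form_nil_nil]
            simp only [mul_one, star_mul, star_star]
            refine φ_eq_zero_of_E (e := reverse e) ?_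
            rw [G.E_reverse_mul_transfer, G.E_reverse_transfer_mul, hb, mul_zero, zero_mul]
    · rw [inner_vacuum_wordOp_edgeOp_of_length_ne (ht.2.lmul _) e h1, map_zero]

lemma isFundamentalOn_toPath (e : q ⟶ x) : IsFundamentalOn (G.pathFunctional e.toPath) where
  apply_nil a := by
    rw [pathFunctional_apply, Ω_toPath, edgeOp_vacuum, wordOp_nil, ← φ_transfer e]
    have h : leftAct x a ∘L wordOp x (cons e 1 (nil 1)) = wordOp x (cons e a (nil 1)) := by
      rw [← wordOp_lmul, lmul_cons, mul_one]
    have ha : (cons e a (nil 1) : Word G.toGraphWithExpectations q x).Reduced := ⟨.nil _ _, trivial⟩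
    rw [← ContinuousLinearMap.comp_apply, h, inner_wordOp_vacuum (reduced_edge e) ha]
    simp
  apply_reduced _ ht h := pathFunctional_toPath_reduced e ht h

/-- The functional of the path `g e` is that of `e`, evaluated at `u_g^* T u_g`. This operator is
given by a word, so the values for `e` are those for the trivial path, and the functional of the
trivial path, evaluated at `u_g^* T u_g`, is that of `g`. -/
lemma isFundamentalOn_pathFunctional (g : Quiver.Path q p) :
    IsFundamentalOn (G.pathFunctional g) := by
  induction g with
  | nil => exact isFundamentalOn_nil
  | @cons y p g e ih =>
    have key : ∀ t : Word G.toGraphWithExpectations q q,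
        G.pathFunctional (g.cons e) (wordOp p t) = G.pathFunctional g (wordOp y t) := by
      intro t
      set s := (ofPath G.toGraphWithExpectations g).revAppend
        (t.append (ofPath G.toGraphWithExpectations g)) with hs
      have h1 : G.pathFunctional (g.cons e) (wordOp p t)
          = G.pathFunctional e.toPath (wordOp p s) := by
        rw [pathFunctional_apply, pathFunctional_apply, Ω_cons, ← wordOp_ofPath, Ω_toPath, hs,
          ← inner_wordOp_left, wordOp_append]
        rfl
      have h2 : G.pathFunctional g (wordOp y t)
          = G.pathFunctional .nil (wordOp y s) := by
        rw [pathFunctional_apply, pathFunctional_apply, Ω_eq_wordOp, Ω_nil, hs,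
          ← inner_wordOp_left, wordOp_append]
        rfl
      rw [h1, h2]
      exact (isFundamentalOn_toPath e).eq isFundamentalOn_nil s
    exact ⟨fun a => (key _).trans (ih.apply_nil a),
      fun t ht h => (key t).trans (ih.apply_reduced t ht h)⟩

end GraphWithStates

/-! ### Density of the reduced operators -/

namespace GraphWithExpectations

open Word

variable {V : Type u} [Quiver.{v} V] [Quiver.HasInvolutiveReverse V]
  {G : GraphWithExpectations.{u, v, w, w'} V} {q x p p₀ : V}

lemma fundamentalOp_coe (t : Word G p₀ p₀) :
    ((fundamentalOp p t : G.fundamentalAlgebra p₀ p) : adjointable (G.A p) (G.PathModule p₀ p)).1 =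
      wordOp p t := rfl

/-- The span of the operators of the words from `q` to `x`, for one base. -/
noncomputable def wordSpan (G : GraphWithExpectations.{u, v, w, w'} V) (p q x : V) :
    Submodule ℂ (G.PathModule x p →L[ℂ] G.PathModule q p) :=
  Submodule.span ℂ (Set.range fun t : Word G q x => wordOp p t)

lemma wordOp_mem_wordSpan (t : Word G q x) : wordOp p t ∈ G.wordSpan p q x :=
  Submodule.subset_span ⟨t, rfl⟩

lemma mul_mem_wordSpan {T S : G.PathModule q p →L[ℂ] G.PathModule q p}
    (hT : T ∈ G.wordSpan p q q) (hS : S ∈ G.wordSpan p q q) : T * S ∈ G.wordSpan p q q := by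
  have h := Submodule.mul_mem_mul hT hS
  rw [wordSpan, Submodule.span_mul_span] at h
  refine Submodule.span_mono ?_ h
  rintro _ ⟨_, ⟨t, rfl⟩, _, ⟨s, rfl⟩, rfl⟩
  exact ⟨t.append s, wordOp_append t s⟩

lemma exists_isAdjointOp_mem_wordSpan {T : G.PathModule x p →L[ℂ] G.PathModule q p}
    (hT : T ∈ G.wordSpan p q x) : ∃ S ∈ G.wordSpan p x q, IsAdjointOp (G.A p) T S := by
  induction hT using Submodule.span_induction with
  | mem T hT =>
    obtain ⟨t, rfl⟩ := hT
    exact ⟨_, wordOp_mem_wordSpan _, isAdjointOp_wordOp t⟩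
  | zero => exact ⟨0, zero_mem _, fun a b => by simp⟩
  | add T T' _ _ h h' =>
    obtain ⟨S, hS, h⟩ := h
    obtain ⟨S', hS', h'⟩ := h'
    refine ⟨S + S', add_mem hS hS', fun a b => ?_⟩
    rw [add_apply, add_apply, PreHilbertModule.inner_add_left, PreHilbertModule.inner_add_right,
      h, h']
  | smul c T _ h =>
    obtain ⟨S, hS, h⟩ := h
    refine ⟨star c • S, Submodule.smul_mem _ _ hS, fun a b => ?_⟩
    rw [smul_apply, smul_apply, PreHilbertModule.inner_smul_left,
      PreHilbertModule.inner_smul_right, h]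

lemma mem_wordSpan_of_mem_adjoin {T : adjointable (G.A p) (G.PathModule p₀ p)}
    (hT : T ∈ StarAlgebra.adjoin ℂ (G.fundamentalGenerators p₀ p)) :
    T.1 ∈ G.wordSpan p p₀ p₀ := by
  induction hT using StarAlgebra.adjoin_induction with
  | mem T hT =>
    obtain ⟨q, z, g, a, S, hS, hT⟩ := hT
    obtain ⟨z', hz', -⟩ := exists_isAdjointOp_pathOp (G := G) (p := p) z
    rw [hT, hS.unique hz', ← wordOp_ofPath, ← wordOp_ofPath, ← wordOp_lmul, ← wordOp_append]
    exact wordOp_mem_wordSpan _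
  | algebraMap c =>
    have h := Submodule.smul_mem _ c (wordOp_mem_wordSpan (p := p) (nil (1 : G.A p₀)))
    rwa [wordOp_nil, leftAct_one] at h
  | add T S _ _ hT hS => exact add_mem hT hS
  | mul T S _ _ hT hS => exact mul_mem_wordSpan hT hS
  | star T _ hT =>
    obtain ⟨S, hS, h⟩ := exists_isAdjointOp_mem_wordSpan hT
    rwa [adjointable.star_eq h]

/-- The reduced operators span a dense subspace of `P_p(p₀)`. -/
lemma mem_of_isClosed_of_reduced {K : Submodule ℂ (G.fundamentalAlgebra p₀ p)}
    (hK : IsClosed (K : Set (G.fundamentalAlgebra p₀ p)))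
    (h : ∀ t : Word G p₀ p₀, t.Reduced → fundamentalOp p t ∈ K) (T : G.fundamentalAlgebra p₀ p) :
    T ∈ K := by
  let ι : G.fundamentalAlgebra p₀ p →ₗ[ℂ] (G.PathModule p₀ p →L[ℂ] G.PathModule p₀ p) :=
    (adjointable (G.A p) (G.PathModule p₀ p)).val.toLinearMap ∘ₗ
      (G.fundamentalAlgebra p₀ p).subtype.toAlgHom.toLinearMap
  have hι : Function.Injective ι := fun _ _ h => Subtype.ext (Subtype.ext h)
  have hw : G.wordSpan p p₀ p₀ ≤ K.map ι := by
    refine Submodule.span_le.2 ?_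
    rintro _ ⟨t, rfl⟩
    -- modulo the image of `K`, all word operators vanish because the reduced ones do
    have := eq_of_eq_on_reduced (p := p) (p' := p) (K.map ι).mkQ 0 (fun t ht =>
      (Submodule.Quotient.mk_eq_zero _).2 ⟨fundamentalOp p t, h t ht, rfl⟩) t
    exact (Submodule.Quotient.mk_eq_zero _).1 this
  have hd : T ∈ closure {S : G.fundamentalAlgebra p₀ p |
      S.1 ∈ StarAlgebra.adjoin ℂ (G.fundamentalGenerators p₀ p)} := by
    rw [closure_subtype]
    have hT : T.1 ∈ closure
        (StarAlgebra.adjoin ℂ (G.fundamentalGenerators p₀ p) :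
          Set (adjointable (G.A p) (G.PathModule p₀ p))) := T.2
    refine closure_mono ?_ hT
    intro S hS
    exact ⟨⟨S, StarSubalgebra.le_topologicalClosure _ hS⟩, hS, rfl⟩
  refine closure_minimal (fun S hS => ?_) hK hd
  obtain ⟨S', hS', h'⟩ := hw (mem_wordSpan_of_mem_adjoin hS)
  rwa [← hι h']

lemma isClosed_fundamentalAlgebra :
    IsClosed (G.fundamentalAlgebra p₀ p : Set (adjointable (G.A p) (G.PathModule p₀ p))) :=
  StarSubalgebra.isClosed_topologicalClosure _

/-- Continuous linear maps which agree on the reduced operators are equal. -/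
lemma eq_of_eqOn_fundamentalOp {M : Type*} [AddCommGroup M] [Module ℂ M] [TopologicalSpace M]
    [T2Space M] {F F' : G.fundamentalAlgebra p₀ p →ₗ[ℂ] M} (hF : Continuous F)
    (hF' : Continuous F')
    (h : ∀ t : Word G p₀ p₀, t.Reduced → F (fundamentalOp p t) = F' (fundamentalOp p t)) :
    F = F' :=
  LinearMap.ext fun T => mem_of_isClosed_of_reduced (K := LinearMap.eqLocus F F')
    (isClosed_eq hF hF') h T

end GraphWithExpectations

/-! ### Generalities on states, unitaries and representations -/

section General

lemma IsState.continuous {A : Type*} [CStarAlgebra A] {φ : A →ₗ[ℂ] ℂ} (hφ : IsState φ) :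
    Continuous φ := by
  let _ : PartialOrder A := CStarAlgebra.spectralOrder _
  have _ : StarOrderedRing A := CStarAlgebra.spectralOrderedRing _
  exact map_continuous (PositiveLinearMap.mk₀ φ fun _ h => hφ.nonneg h)

lemma denseRange_linearCombination {ι H : Type*} [NormedAddCommGroup H] [InnerProductSpace ℂ H]
    {v : ι → H} (hv : (Submodule.span ℂ (Set.range v)).topologicalClosure = ⊤) :
    DenseRange (Finsupp.linearCombination ℂ v) := by
  rw [DenseRange, ← LinearMap.coe_range, Finsupp.range_linearCombination]
  exact Submodule.dense_iff_topologicalClosure_eq_top.2 hv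

/-- Two total families in Hilbert spaces with the same Gram matrix are unitarily equivalent. -/
lemma exists_linearIsometryEquiv_of_inner_eq {ι H K : Type*} [NormedAddCommGroup H]
    [InnerProductSpace ℂ H] [CompleteSpace H] [NormedAddCommGroup K] [InnerProductSpace ℂ K]
    [CompleteSpace K] {v : ι → H} {k : ι → K}
    (hv : (Submodule.span ℂ (Set.range v)).topologicalClosure = ⊤)
    (hk : (Submodule.span ℂ (Set.range k)).topologicalClosure = ⊤)
    (h : ∀ i j, inner ℂ (v i) (v j) = inner ℂ (k i) (k j)) :
    ∃ U : H ≃ₗᵢ[ℂ] K, ∀ i, U (v i) = k i := by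
  have hn : ∀ c : ι →₀ ℂ,
      ‖Finsupp.linearCombination ℂ k c‖ = ‖Finsupp.linearCombination ℂ v c‖ := by
    intro c
    rw [@norm_eq_sqrt_re_inner ℂ, @norm_eq_sqrt_re_inner ℂ]
    simp only [Finsupp.linearCombination_apply, Finsupp.sum_inner, Finsupp.inner_sum,
      inner_smul_left, inner_smul_right, h]
  refine ⟨(LinearEquiv.refl ℂ (ι →₀ ℂ)).extendOfIsometry _ _ (denseRange_linearCombination hv)
    (denseRange_linearCombination hk) hn, fun i => ?_⟩
  have := LinearEquiv.extendOfIsometry_eq (LinearEquiv.refl ℂ (ι →₀ ℂ)) _ _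
    (denseRange_linearCombination hv) (denseRange_linearCombination hk) hn (Finsupp.single i 1)
  simpa using this

/-- Injective ⋆-homomorphisms with the same range induce an isomorphism of their domains. -/
lemma exists_starAlgEquiv_of_range_eq {A B C : Type*} [CStarAlgebra A] [CStarAlgebra B]
    [CStarAlgebra C] {α : A →⋆ₐ[ℂ] C} {β : B →⋆ₐ[ℂ] C} (hα : Function.Injective α)
    (hβ : Function.Injective β) (h : α.range = β.range) :
    ∃ Φ : A ≃⋆ₐ[ℂ] B, ∀ a, β (Φ a) = α a := by
  let γ : A →⋆ₐ[ℂ] B := (StarAlgEquiv.ofInjective β hβ).symm.toStarAlgHom.comp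
    (α.codRestrict β.range fun a => h ▸ ⟨a, rfl⟩)
  have hγ : ∀ a, β (γ a) = α a := fun a =>
    congrArg Subtype.val ((StarAlgEquiv.ofInjective β hβ).apply_symm_apply
      (α.codRestrict β.range (fun a => h ▸ ⟨a, rfl⟩) a))
  have hb : Function.Bijective γ := by
    refine ⟨fun a a' haa => hα (by rw [← hγ, ← hγ, haa]), fun b => ?_⟩
    obtain ⟨a, ha⟩ : β b ∈ α.range := h ▸ ⟨b, rfl⟩
    exact ⟨a, hβ ((hγ a).trans ha)⟩
  exact ⟨StarAlgEquiv.ofBijective γ hb, hγ⟩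

section GNS

variable {A E : Type*} [CStarAlgebra A] [PartialOrder A] [StarOrderedRing A]
  [NormedAddCommGroup E] [NormedSpace ℂ E] [SMul Aᵐᵒᵖ E] [PreHilbertModule A E]
  {φ : A →ₗ[ℂ] ℂ} (hφ : IsState φ)

lemma inner_gnsVector (a b : E) :
    inner ℂ (gnsVector E hφ a) (gnsVector E hφ b) = φ (inner A a b) :=
  Completion.inner_coe _ _

lemma denseRange_gnsVector : DenseRange (gnsVector E hφ) :=
  Completion.denseRange_coe (α := PreGNSSpace E hφ)

lemma continuous_gnsVector : Continuous (gnsVector E hφ) := by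
  let F : A →L[ℂ] ℂ := ⟨φ, hφ.continuous⟩
  refine AddMonoidHomClass.continuous_of_bound (gnsVector E hφ) (√‖F‖) fun a => ?_
  rw [← pow_le_pow_iff_left₀ (norm_nonneg _) (by positivity) two_ne_zero, mul_pow,
    Real.sq_sqrt (norm_nonneg _), PreHilbertModule.norm_sq_eq (A := A) a,
    @norm_sq_eq_re_inner ℂ, inner_gnsVector]
  exact (Complex.re_le_norm _).trans (F.le_opNorm _)

lemma gnsRep_injective [CompleteSpace E] (h : IsFaithful φ) :
    Function.Injective (gnsRep (E := E) hφ) := by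
  rw [injective_iff_map_eq_zero]
  intro T hT
  refine Subtype.ext (ContinuousLinearMap.ext fun a => ?_)
  have h0 := inner_gnsVector hφ (T.1 a) (T.1 a)
  rw [← gnsRep_gnsVector, hT, zero_apply, inner_zero_left] at h0
  obtain ⟨b, hb⟩ := CStarAlgebra.nonneg_iff_eq_star_mul_self.1
    (PreHilbertModule.inner_self_nonneg (A := A) (T.1 a))
  refine PreHilbertModule.eq_zero_of_inner_self (A := A) ?_
  rw [hb] at h0 ⊢
  rw [h b h0.symm, mul_zero]

end GNS

end General

/-! ### The fundamental state and its GNS construction -/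

namespace GraphWithStates

open GraphWithExpectations Word

variable {V : Type u} [Quiver.{v} V] [Quiver.HasInvolutiveReverse V]
  {G : GraphWithStates.{u, v, w, w'} V} {p₀ p r : V}

/-- The vector state of `ξ` on `P_r(p₀)`. -/
noncomputable def fundamentalState (G : GraphWithStates.{u, v, w, w'} V) (g : Quiver.Path p₀ r) :
    G.P p₀ r →ₗ[ℂ] ℂ :=
  G.pathFunctional g ∘ₗ (adjointable (G.A r) (G.PathModule p₀ r)).val.toLinearMap ∘ₗ
    (G.P p₀ r).subtype.toAlgHom.toLinearMap

lemma π_gnsVector (T : G.P p₀ r) (a : G.PathModule p₀ r) :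
    G.π p₀ r T (gnsVector _ (G.isState r) a) = gnsVector _ (G.isState r) (T.1.1 a) :=
  gnsRep_gnsVector _ _ _

lemma inner_ξ_π_ξ (g : Quiver.Path p₀ r) (T : G.P p₀ r) :
    inner ℂ (G.ξ g) (G.π p₀ r T (G.ξ g)) = G.fundamentalState g T := by
  rw [ξ, π_gnsVector, inner_gnsVector]
  rfl

lemma isFundamentalState_fundamentalState (g : Quiver.Path p₀ r) :
    G.IsFundamentalState p₀ r (G.fundamentalState g) where
  isState := by
    refine ⟨?_, fun T => ?_⟩
    · have h := (isFundamentalOn_pathFunctional (G := G) g).apply_nil 1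
      rw [wordOp_nil, leftAct_one, (G.isState p₀).1] at h
      exact h
    · rw [← inner_ξ_π_ξ, map_mul, map_star, mul_apply_eq_comp,
        ContinuousLinearMap.star_eq_adjoint, ContinuousLinearMap.adjoint_inner_right,
        inner_self_eq_norm_sq_to_K, ← RCLike.ofReal_pow]
      exact RCLike.ofReal_nonneg.2 (sq_nonneg _)
  apply_vertex := (isFundamentalOn_pathFunctional g).apply_nil
  apply_reduced := (isFundamentalOn_pathFunctional g).apply_reduced

lemma IsFundamentalState.unique {φ ψ : G.P p₀ r →ₗ[ℂ] ℂ} (hφ : G.IsFundamentalState p₀ r φ)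
    (hψ : G.IsFundamentalState p₀ r ψ) : φ = ψ := by
  have := isClosed_fundamentalAlgebra (G := G.toGraphWithExpectations) (p := r) (p₀ := p₀)
  refine eq_of_eqOn_fundamentalOp hφ.isState.continuous hψ.isState.continuous fun t ht => ?_
  rcases Nat.eq_zero_or_pos t.length with h | h
  · cases t with
    | nil a => rw [hφ.apply_vertex, hψ.apply_vertex]
    | cons => simp at h
  · rw [hφ.apply_reduced t ht h, hψ.apply_reduced t ht h]

/-- The vector `π(t) ξ` of a closed word `t` at `p₀`. -/
noncomputable def wordVector (G : GraphWithStates.{u, v, w, w'} V) (g : Quiver.Path p₀ r)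
    (t : Word G.toGraphWithExpectations p₀ p₀) : G.H p₀ r :=
  G.π p₀ r (fundamentalOp r t) (G.ξ g)

lemma wordVector_eq (g : Quiver.Path p₀ r) (t : Word G.toGraphWithExpectations p₀ p₀) :
    G.wordVector g t = gnsVector _ (G.isState r) (wordOp r t (G.Ω g)) := by
  rw [wordVector, ξ, π_gnsVector, fundamentalOp_coe]

/-- The vectors `π(t) ξ`, for all closed words `t` at `p₀`, span a dense subspace: as
`u_g^* u_g = 1`, every elementary tensor is of the form `t u_g^* (u_g 1)`. -/
lemma topologicalClosure_span_wordVector (g : Quiver.Path p₀ r) :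
    (Submodule.span ℂ (Set.range (G.wordVector g))).topologicalClosure = ⊤ := by
  rw [eq_top_iff]
  set K := (Submodule.span ℂ (Set.range (G.wordVector g))).topologicalClosure with hK
  have hKc : IsClosed (K : Set (G.H p₀ r)) := Submodule.isClosed_topologicalClosure _
  obtain ⟨g', -, hg⟩ := exists_isAdjointOp_pathOp (G := G.toGraphWithExpectations) (p := r) g
  have hw : ∀ (t : Word G.toGraphWithExpectations p₀ r) (ht : t.Reduced),
      gnsVector _ (G.isState r) ((ofWord t ht : G.PathSpace p₀ r) : G.PathModule p₀ r) ∈ K := by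
    intro t ht
    refine Submodule.le_topologicalClosure _ (Submodule.subset_span
      ⟨t.append (ofPath G.toGraphWithExpectations g'), ?_⟩)
    have h : wordOp r (t.append (ofPath G.toGraphWithExpectations g')) (G.Ω g) =
        (ofWord t ht : G.PathSpace p₀ r) := by
      rw [wordOp_append, wordOp_ofPath, ContinuousLinearMap.comp_apply, ← wordOp_vacuum ht]
      exact congrArg _ (DFunLike.congr_fun hg _)
    rw [wordVector_eq, h]
  have hmod : ∀ z : G.PathModule p₀ r, gnsVector _ (G.isState r) z ∈ K := by
    intro z
    refine Completion.induction_on z (hKc.preimage (continuous_gnsVector _)) fun z => ?_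
    induction z using pathSpace_induction with
    | h0 => rw [Completion.coe_zero, map_zero]; exact zero_mem _
    | ha a b ha hb => rw [Completion.coe_add, map_add]; exact add_mem ha hb
    | hw c t ht => rw [Completion.coe_smul, map_smul]; exact Submodule.smul_mem _ _ (hw t ht)
  intro z _
  exact (denseRange_gnsVector (E := G.PathModule p₀ r) (G.isState r)).induction_on
    (p := fun z => z ∈ K) z hKc hmod

lemma denseRange_π_ξ (g : Quiver.Path p₀ r) :
    DenseRange fun T : G.P p₀ r => G.π p₀ r T (G.ξ g) := by
  refine (Submodule.dense_iff_topologicalClosure_eq_top.2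
    (topologicalClosure_span_wordVector g)).mono ?_
  let L : G.P p₀ r →ₗ[ℂ] G.H p₀ r :=
    (ContinuousLinearMap.apply ℂ (G.H p₀ r) (G.ξ g)).toLinearMap ∘ₗ
      (G.π p₀ r).toAlgHom.toLinearMap
  have h : Submodule.span ℂ (Set.range (G.wordVector g)) ≤ LinearMap.range L := by
    refine Submodule.span_le.2 ?_
    rintro _ ⟨t, rfl⟩
    exact ⟨fundamentalOp r t, rfl⟩
  exact h

/-! ### Independence of the base -/

lemma π_fundamentalOp_wordVector (g : Quiver.Path p₀ r)
    (t s : Word G.toGraphWithExpectations p₀ p₀) :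
    G.π p₀ r (fundamentalOp r t) (G.wordVector g s) = G.wordVector g (t.append s) := by
  rw [wordVector_eq, wordVector_eq, π_gnsVector, fundamentalOp_coe, wordOp_append]
  rfl

lemma inner_wordVector (g : Quiver.Path p₀ r) (t s : Word G.toGraphWithExpectations p₀ p₀) :
    inner ℂ (G.wordVector g t) (G.wordVector g s) =
      G.pathFunctional g (wordOp r (t.revAppend s)) := by
  rw [wordVector_eq, wordVector_eq, inner_gnsVector, inner_wordOp_left]
  rfl

/-- The representations `π_{p₀,φ_p}` and `π_{p₀,φ_{p'}}` are unitarily equivalent, since the vectors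
`π(t) ξ` have the same Gram matrix for both bases. -/
lemma exists_unitary (g : Quiver.Path p₀ p) (g' : Quiver.Path p₀ r) :
    ∃ U : G.H p₀ p ≃ₗᵢ[ℂ] G.H p₀ r, ∀ t : Word G.toGraphWithExpectations p₀ p₀,
      ∀ η, U (G.π p₀ p (fundamentalOp p t) (U.symm η)) = G.π p₀ r (fundamentalOp r t) η := by
  obtain ⟨U, hU⟩ := exists_linearIsometryEquiv_of_inner_eq
    (topologicalClosure_span_wordVector (G := G) g) (topologicalClosure_span_wordVector g')
    fun t s => by
      rw [inner_wordVector, inner_wordVector]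
      exact (isFundamentalOn_pathFunctional g).eq (isFundamentalOn_pathFunctional g') _
  refine ⟨U, fun t η => ?_⟩
  rw [← LinearIsometryEquiv.conjStarAlgEquiv_apply_apply]
  refine DFunLike.congr_fun (ContinuousLinearMap.ext_on
    (Submodule.dense_iff_topologicalClosure_eq_top.2 (topologicalClosure_span_wordVector g')) ?_) η
  rintro _ ⟨s, rfl⟩
  rw [LinearIsometryEquiv.conjStarAlgEquiv_apply_apply, ← hU s, U.symm_apply_apply,
    π_fundamentalOp_wordVector, hU, hU, π_fundamentalOp_wordVector]

lemma π_injective (h : IsFaithful (G.φ r)) : Function.Injective (G.π p₀ r) :=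
  (gnsRep_injective (G.isState r) h).comp Subtype.val_injective

/-- The range of an injective representation of `P_p(p₀)` is contained in the range of another one
as soon as this holds for the reduced operators. -/
lemma range_le_range_of_reduced {C : Type*} [CStarAlgebra C] {α : G.P p₀ p →⋆ₐ[ℂ] C}
    {β : G.P p₀ r →⋆ₐ[ℂ] C} (hβ : Function.Injective β)
    (h : ∀ t : Word G.toGraphWithExpectations p₀ p₀,
      α (fundamentalOp p t) = β (fundamentalOp r t)) : α.range ≤ β.range := by
  have hp := isClosed_fundamentalAlgebra (G := G.toGraphWithExpectations) (p := p) (p₀ := p₀)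
  have hr := isClosed_fundamentalAlgebra (G := G.toGraphWithExpectations) (p := r) (p₀ := p₀)
  rintro _ ⟨T, rfl⟩
  have hcl : IsClosed (Set.range β) :=
    (NonUnitalStarAlgHom.isometry β hβ).isClosedEmbedding.isClosed_range
  have hα : Continuous α :=
    AddMonoidHomClass.continuous_of_bound α 1 fun T => by
      simpa using NonUnitalStarAlgHom.norm_apply_le α T
  have := mem_of_isClosed_of_reduced
    (K := (LinearMap.range β.toAlgHom.toLinearMap).comap α.toAlgHom.toLinearMap)
    (hcl.preimage hα) (fun t _ => ⟨fundamentalOp r t, (h t).symm⟩) T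
  exact this

/-- Faithful representations of `P_r(p₀)` and `P_p(p₀)` which are unitarily equivalent on the words
induce an isomorphism. -/
lemma exists_starAlgEquiv_of_injective {H K : Type*} [NormedAddCommGroup H]
    [InnerProductSpace ℂ H] [CompleteSpace H] [NormedAddCommGroup K] [InnerProductSpace ℂ K]
    [CompleteSpace K] {α : G.P p₀ r →⋆ₐ[ℂ] (K →L[ℂ] K)} {β : G.P p₀ p →⋆ₐ[ℂ] (H →L[ℂ] H)}
    (hα : Function.Injective α) (hβ : Function.Injective β) (U : H ≃ₗᵢ[ℂ] K)
    (h : ∀ t : Word G.toGraphWithExpectations p₀ p₀, ∀ η,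
      U (β (fundamentalOp p t) (U.symm η)) = α (fundamentalOp r t) η) :
    ∃ Φ : G.P p₀ r ≃⋆ₐ[ℂ] G.P p₀ p, ∀ t : Word G.toGraphWithExpectations p₀ p₀,
      Φ (fundamentalOp r t) = fundamentalOp p t := by
  have hp := isClosed_fundamentalAlgebra (G := G.toGraphWithExpectations) (p := p) (p₀ := p₀)
  have hr := isClosed_fundamentalAlgebra (G := G.toGraphWithExpectations) (p := r) (p₀ := p₀)
  let γ : G.P p₀ p →⋆ₐ[ℂ] (K →L[ℂ] K) := U.conjStarAlgEquiv.toStarAlgHom.comp β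
  have hγ : Function.Injective γ := U.conjStarAlgEquiv.injective.comp hβ
  have hαγ : ∀ t, α (fundamentalOp r t) = γ (fundamentalOp p t) := fun t =>
    ContinuousLinearMap.ext fun η => (h t η).symm
  obtain ⟨Φ, hΦ⟩ := exists_starAlgEquiv_of_range_eq hα hγ
    (le_antisymm (range_le_range_of_reduced hγ hαγ)
      (range_le_range_of_reduced hα fun t => (hαγ t).symm))
  exact ⟨Φ, fun t => hγ ((hΦ _).trans (hαγ t))⟩

lemma starAlgEquiv_unique {Φ Ψ : G.P p₀ r ≃⋆ₐ[ℂ] G.P p₀ p}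
    (h : ∀ t : Word G.toGraphWithExpectations p₀ p₀, t.Reduced →
      Φ (fundamentalOp r t) = Ψ (fundamentalOp r t)) : Φ = Ψ := by
  have hp := isClosed_fundamentalAlgebra (G := G.toGraphWithExpectations) (p := p) (p₀ := p₀)
  have hr := isClosed_fundamentalAlgebra (G := G.toGraphWithExpectations) (p := r) (p₀ := p₀)
  have := eq_of_eqOn_fundamentalOp
    (F := Φ.toStarAlgHom.toAlgHom.toLinearMap) (F' := Ψ.toStarAlgHom.toAlgHom.toLinearMap)
    (StarAlgEquiv.isometry Φ).continuous (StarAlgEquiv.isometry Ψ).continuous h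
  exact StarAlgEquiv.ext fun T => LinearMap.congr_fun this T

lemma existsUnique_starAlgEquiv (hr : IsFaithful (G.φ r)) (hp : IsFaithful (G.φ p)) :
    ∃! Φ : G.P p₀ r ≃⋆ₐ[ℂ] G.P p₀ p, ∀ t : Word G.toGraphWithExpectations p₀ p₀, t.Reduced →
      Φ (fundamentalOp r t) = fundamentalOp p t := by
  obtain ⟨g⟩ := G.connected p₀ p
  obtain ⟨g'⟩ := G.connected p₀ r
  refine (exists_unitary (G := G) g g').elim fun U hU => ?_
  refine (exists_starAlgEquiv_of_injective (π_injective hr) (π_injective hp) U hU).elim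
    fun Φ hΦ => ?_
  exact ⟨Φ, fun t _ => hΦ t, fun Ψ hΨ => starAlgEquiv_unique fun t ht =>
    (hΨ t ht).trans (hΦ t).symm⟩

end GraphWithStates

theorem mainTheorem8 {V : Type u} [Quiver.{v} V] [Quiver.HasInvolutiveReverse V]
    (G : GraphWithStates.{u, v, w, w'} V) (p₀ p : V) :
    -- for every base `r`, the fundamental state of `P_r(p₀)` exists and is unique, and
    -- `(H_{p₀,φ_r}, π, ξ)` is its GNS construction
    (∀ r : V, ∃ φ : G.P p₀ r →ₗ[ℂ] ℂ, G.IsFundamentalState p₀ r φ ∧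
      (∀ ψ, G.IsFundamentalState p₀ r ψ → ψ = φ) ∧
      ∀ g : Quiver.Path p₀ r, NonBacktracking g →
        (∀ x : G.P p₀ r, inner ℂ (G.ξ g) (G.π p₀ r x (G.ξ g)) = φ x) ∧
        DenseRange fun x : G.P p₀ r => G.π p₀ r x (G.ξ g)) ∧
    -- the GNS representations are unitarily equivalent
    (∃ U : G.H p₀ p ≃ₗᵢ[ℂ] G.H p₀ p₀,
      ∀ t : Word G.toGraphWithExpectations p₀ p₀, t.Reduced → ∀ η : G.H p₀ p₀,
        U (G.π p₀ p (GraphWithExpectations.fundamentalOp p t) (U.symm η)) =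
          G.π p₀ p₀ (GraphWithExpectations.fundamentalOp p₀ t) η) ∧
    -- independence of the base for faithful states
    (IsFaithful (G.φ p₀) → IsFaithful (G.φ p) →
      ∃! Φ : G.P p₀ p₀ ≃⋆ₐ[ℂ] G.P p₀ p,
        ∀ t : Word G.toGraphWithExpectations p₀ p₀, t.Reduced →
          Φ (GraphWithExpectations.fundamentalOp p₀ t) =
            GraphWithExpectations.fundamentalOp p t) := by
  refine ⟨fun r => ?_, ?_, fun h₀ h => ?_⟩
  · obtain ⟨g₀⟩ := G.connected p₀ r
    have hφ := GraphWithStates.isFundamentalState_fundamentalState (G := G) g₀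
    refine ⟨_, hφ, fun ψ hψ => hψ.unique hφ, fun g _ => ⟨fun x => ?_, G.denseRange_π_ξ g⟩⟩
    rw [GraphWithStates.inner_ξ_π_ξ,
      (GraphWithStates.isFundamentalState_fundamentalState g).unique hφ]
  · obtain ⟨g⟩ := G.connected p₀ p
    exact (GraphWithStates.exists_unitary (G := G) g .nil).imp fun U hU t _ => hU t
  · exact GraphWithStates.existsUnique_starAlgEquiv h₀ h
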